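/- Let $d\ge 2$ be an integer and let $\alpha>d$, $\beta>1$, $\eta>0$, $\xi\in\mathbb R$ be real numbers. Let $S=(-\tfrac12,\tfrac12]^d$ carry the toroidal metric $d(x,y)=\inf\{\|x-y-z\| : z\in\mathbb Z^d\}$, where $\|\cdot\|$ is the Euclidean norm. For $s>0$ let $\mathcal P_s$ be a homogeneous Poisson point process of intensity $s$ on $S$. Give the points $x\in\mathcal P_s$ independent weights $W_x$ with $P(W_x>w)=w^{-\beta}$ for $w\ge 1$ (so $W_x\ge1$ almost surely). For $r>0$ let $G(\mathcal P_s,r)$ be the random graph with vertex set $\mathcal P_s$ in which, given the points and the weights, each pair of distinct vertices $x,y$ is joined by an edge, independently over the pairs, with probability $$1-\exp\left(-\frac{\eta W_xW_y}{(d(x,y)/r)^{\alpha}}\right).$$ For an integer $k\ge 0$ and all $s$ so large that the right-hand side below is positive, define $r_s>0$ by $$r_s^d=\frac1{c_0s}\left(\log s+(k-1)\log\log s+\xi+\log\left(\frac{\alpha\beta}{k!\,d}\right)\right),\qquad c_0=\frac{\sigma_d\,\alpha\beta}{d(\alpha\beta-d)}\,\eta^{d/\alpha}\,\Gamma\left(1-\frac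 d\alpha\right),$$ where $\sigma_d=2\pi^{d/2}/\Gamma(d/2)$ is the surface area of the unit sphere of $\mathbb R^d$ (so $\sigma_2=2\pi$). Let $D_k$ be the number of vertices of degree $k$ in $G(\mathcal P_s,r_s)$. Then for every $k\ge 0$ the variable $D_k$ is integrable and $$E[D_k]\to e^{-\xi}\qquad\text{as } s\to\infty .$$ -/

import Mathlib

open MeasureTheory ProbabilityTheory Filter Topology

noncomputable section

namespace ScaleFreeRCM

/-- The cube `S = (-1/2, 1/2]^d`. -/
def cube (d : ℕ) : Set (EuclideanSpace ℝ (Fin d)) :=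
  {x | ∀ i, x i ∈ Set.Ioc (-1 / 2 : ℝ) (1 / 2)}

/-- The toroidal metric `d(x, y) = inf {‖x - y - z‖ : z ∈ ℤ^d}`, with the Euclidean norm. -/
def torusDist {d : ℕ} (x y : EuclideanSpace ℝ (Fin d)) : ℝ :=
  ⨅ z : Fin d → ℤ, ‖x - y - WithLp.toLp 2 (fun i => (z i : ℝ))‖

theorem torusDist_comm {d : ℕ} (x y : EuclideanSpace ℝ (Fin d)) :
    torusDist x y = torusDist y x := by
  unfold torusDist
  refine (Equiv.neg (Fin d → ℤ)).iInf_congr fun z => ?_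
  rw [← norm_neg]
  congr 1
  ext i
  simp
  ring

/-- The connection function
`g(x, w; y, w') = 1 - exp (- η w w' / (d(x, y) / r)^α)` at scale `r`. -/
def connProb {d : ℕ} (α η r : ℝ) (x : EuclideanSpace ℝ (Fin d)) (w : ℝ)
    (y : EuclideanSpace ℝ (Fin d)) (w' : ℝ) : ℝ :=
  1 - Real.exp (-(η * w * w' / (torusDist x y / r) ^ α))

theorem connProb_comm {d : ℕ} (α η r : ℝ) (x : EuclideanSpace ℝ (Fin d)) (w : ℝ)
    (y : EuclideanSpace ℝ (Fin d)) (w' : ℝ) :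
    connProb α η r x w y w' = connProb α η r y w' x w := by
  unfold connProb
  rw [torusDist_comm, mul_right_comm]

/-- The sample space: the number of points of the Poisson process, the locations of the points,
their weights, and one auxiliary variable for every unordered pair of points.
Only the points with label smaller than the number of points belong to the process. -/
abbrev Sample (d : ℕ) : Type :=
  ℕ × (ℕ → EuclideanSpace ℝ (Fin d)) × (ℕ → ℝ) × (Sym2 ℕ → ℝ)

/-- The law of the model with intensity `s`. A Poisson(`s`) number of independent points, uniform
on the cube (that is, a homogeneous Poisson point process of intensity `s` on the cube);
independent weights with the Pareto law `P(W > w) = w^(-β)`, `w ≥ 1`; independent uniform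
variables on `[0, 1]` attached to the pairs of points; all of these independent. -/
def law (d : ℕ) (β s : ℝ) : Measure (Sample d) :=
  (poissonMeasure s.toNNReal).prod
    ((Measure.infinitePi fun _ : ℕ => volume.restrict (cube d)).prod
      ((Measure.infinitePi fun _ : ℕ => paretoMeasure 1 β).prod
        (Measure.infinitePi fun _ : Sym2 ℕ => volume.restrict (Set.Icc (0 : ℝ) 1))))

theorem volume_cube (d : ℕ) : volume (cube d) = 1 := by
  have h : cube d = (MeasurableEquiv.toLp 2 (Fin d → ℝ)).symm ⁻¹'
      (Set.univ.pi fun _ => Set.Ioc (-1 / 2 : ℝ) (1 / 2)) := by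
    ext x
    simp [cube, Set.mem_pi]
  rw [h, (EuclideanSpace.volume_preserving_symm_measurableEquiv_toLp (Fin d)).measure_preimage
    (MeasurableSet.univ_pi fun _ => measurableSet_Ioc).nullMeasurableSet, volume_pi_pi]
  norm_num

/-- The law of the model is a probability measure. -/
theorem isProbabilityMeasure_law (d : ℕ) {β : ℝ} (hβ : 0 < β) (s : ℝ) :
    IsProbabilityMeasure (law d β s) := by
  have h1 : IsProbabilityMeasure (volume.restrict (cube d)) := ⟨by simp [volume_cube]⟩
  have h2 : IsProbabilityMeasure (paretoMeasure 1 β) :=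
    isProbabilityMeasure_paretoMeasure one_pos hβ
  have h3 : IsProbabilityMeasure (volume.restrict (Set.Icc (0 : ℝ) 1)) := ⟨by simp⟩
  unfold law
  infer_instance

/-- The random graph `G(P_s, r)`. Its vertices are the points of the Poisson process; given points
and weights, two distinct vertices are joined by an edge with probability `connProb`,
independently over the pairs. -/
def graph {d : ℕ} (α η r : ℝ) (ω : Sample d) : SimpleGraph (Fin ω.1) where
  Adj i j := i ≠ j ∧
    ω.2.2.2 s((i : ℕ), (j : ℕ)) <
      connProb α η r (ω.2.1 i) (ω.2.2.1 i) (ω.2.1 j) (ω.2.2.1 j)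
  symm := ⟨fun i j h => ⟨h.1.symm, by rw [Sym2.eq_swap, connProb_comm]; exact h.2⟩⟩
  loopless := ⟨fun _ h => h.1 rfl⟩

open Classical in
/-- `D_k`, the number of vertices of degree `k`. -/
def numDegree {d : ℕ} (α η r : ℝ) (k : ℕ) (ω : Sample d) : ℕ :=
  (Finset.univ.filter fun i : Fin ω.1 => (graph α η r ω).degree i = k).card

/-- The surface area of the unit sphere of `ℝ^d`. -/
def sphereArea (d : ℕ) : ℝ :=
  2 * Real.pi ^ ((d : ℝ) / 2) / Real.Gamma ((d : ℝ) / 2)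

theorem sphereArea_two : sphereArea 2 = 2 * Real.pi := by
  simp [sphereArea]

/-- The constant `c₀`. -/
def c₀ (d : ℕ) (α β η : ℝ) : ℝ :=
  sphereArea d * α * β / (d * (α * β - d)) * η ^ ((d : ℝ) / α) * Real.Gamma (1 - d / α)

/-- The scaling parameter `r_s(ξ)`: the number with `r_s(ξ)^d =
(log s + (k - 1) log log s + ξ + log (αβ / (k! d))) / (c₀ s)`. The right side is positive for all
large `s`, and then the real power below is its positive `d`-th root. -/
def scale (d : ℕ) (α β η ξ : ℝ) (k : ℕ) (s : ℝ) : ℝ :=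
  (1 / (c₀ d α β η * s) *
    (Real.log s + ((k : ℝ) - 1) * Real.log (Real.log s) + ξ +
      Real.log (α * β / (k.factorial * d)))) ^ (1 / (d : ℝ))

end ScaleFreeRCM

end

/-! The expectation reduces to a one-dimensional integral over the weight of a typical vertex. Given
location and weight `w`, the other points are joined to it independently, each with the same mean
probability L(w) (`connMass`), which is free of the location because the torus is homogeneous.
Summing over a Poisson number of points thins the binomial degree to a Poisson one
(`lintegral_numDegree`), so E[D_k] = s E[(sL(W))^k e^{-sL(W)} / k!] with W Pareto.

In the whole space the connection mass is exactly c₀ r^d w^{d/α}: a layer-cake integral over balls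
gives the Gamma factor, and averaging over the second weight gives αβ/(αβ - d). Restricting to the
cube costs at most K r^α w (`exists_connMass_bounds`). At r = r_s the mean degree sL(w) is therefore
m w^{d/α} up to K s r_s^α w, where m = c₀ s r_s^d grows like log s, and s r_s^α → 0 because α > d.

Only weights within order 1/m of the minimal weight 1 matter. Putting w = 1 + v/m turns e^{m -
sL(w)} into about e^{-(d/α)v}, so the weight integral of (sL/m)^k e^{m - sL} is asymptotic to
αβ/(dm) (`tendsto_laplace`). Hence E[D_k] is asymptotic to s m^{k-1} e^{-m} αβ/(k! d), and the log
log and constant terms of r_s are exactly those that make this tend to e^{-ξ}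
(`tendsto_mul_exp_neg_meanDegree`). -/

noncomputable section

namespace ScaleFreeRCM

open scoped ENNReal

/-! ### Products of functions of coordinates under infinite product measures. -/

/-- Under a product of copies of `μ`, a product of functions of the pairs `(x i, x j)`, `j ∈ T`,
integrates to the product of the partial integrals given `x i`. -/
theorem lintegral_infinitePi_prod_pair {ι X : Type*} [MeasurableSpace X] (μ : Measure X)
    [IsProbabilityMeasure μ] (i : ι) (T : Finset ι) (hi : i ∉ T) (F : ι → X → X → ℝ≥0∞)
    (hF : ∀ j, Measurable (Function.uncurry (F j))) :
    ∫⁻ x, ∏ j ∈ T, F j (x i) (x j) ∂(Measure.infinitePi fun _ : ι => μ) =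
      ∫⁻ a, ∏ j ∈ T, ∫⁻ b, F j a b ∂μ ∂μ := by
  set ν := Measure.infinitePi fun _ : ι => μ with hν
  have hind : iIndepFun (fun (j : ι) (x : ι → X) => x j) ν :=
    iIndepFun_infinitePi (X := fun _ x => x) (fun _ => measurable_id)
  have hpair : IndepFun (fun x : ι → X => x i) (fun x (j : T) => x j) ν := by
    have h := hind.indepFun_finset {i} T (by simpa using hi) (fun j => measurable_pi_apply j)
    have hm : Measurable fun y : ({i} : Finset ι) → X => y ⟨i, Finset.mem_singleton_self i⟩ :=
      measurable_pi_apply _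
    exact h.comp hm measurable_id
  have hT : Measurable (fun (x : ι → X) (j : T) => x j) := by fun_prop
  have hmap := (indepFun_iff_map_prod_eq_prod_map_map (measurable_pi_apply i).aemeasurable
    hT.aemeasurable).1 hpair
  have hmi : ν.map (fun x => x i) = μ := Measure.infinitePi_map_eval (fun _ => μ) i
  rw [hmi] at hmap
  have hg : Measurable fun p : X × (T → X) => ∏ j : T, F j p.1 (p.2 j) :=
    Finset.measurable_prod _ fun j _ =>
      (hF j).comp (measurable_fst.prodMk ((measurable_pi_apply j).comp measurable_snd))
  have : IsProbabilityMeasure (ν.map fun x (j : T) => x j) :=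
    Measure.isProbabilityMeasure_map hT.aemeasurable
  calc ∫⁻ x, ∏ j ∈ T, F j (x i) (x j) ∂ν
      = ∫⁻ x, (fun p : X × (T → X) => ∏ j : T, F j p.1 (p.2 j))
          (x i, fun j : T => x j) ∂ν := by
        refine lintegral_congr fun x => ?_
        exact (Finset.prod_coe_sort T fun j => F j (x i) (x j)).symm
    _ = ∫⁻ p, ∏ j : T, F j p.1 (p.2 j) ∂(μ.prod (ν.map fun x (j : T) => x j)) := by
        rw [← hmap, lintegral_map hg ((measurable_pi_apply i).prodMk hT)]
    _ = ∫⁻ a, ∏ j ∈ T, ∫⁻ b, F j a b ∂μ ∂μ := by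
        rw [lintegral_prod _ hg.aemeasurable]
        refine lintegral_congr fun a => ?_
        have hFa : ∀ j, Measurable (F j a) := fun j => (hF j).comp measurable_prodMk_left
        have hga : Measurable fun y : T → X => ∏ j : T, F j a (y j) :=
          Finset.measurable_prod _ fun j _ => (hFa j).comp (measurable_pi_apply j)
        dsimp only
        rw [lintegral_map hga hT]
        have h2 := lintegral_prod_eq_prod_lintegral_of_indepFun (μ := ν) T
          (fun j x => F j a (x j)) (iIndepFun_infinitePi (X := fun j x => F j a x) hFa)
          (fun j => (hFa j).comp (measurable_pi_apply j))
        calc _ = ∫⁻ x, ∏ j ∈ T, F j a (x j) ∂ν := by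
              refine lintegral_congr fun x => ?_
              exact Finset.prod_coe_sort T fun j => F j a (x j)
          _ = _ := h2
          _ = _ := by
              refine Finset.prod_congr rfl fun j _ => ?_
              rw [← Measure.infinitePi_map_eval (fun _ : ι => μ) j,
                lintegral_map (hFa j) (measurable_pi_apply j)]

/-- The integral of a product of functions of distinct coordinates under a product measure. -/
theorem lintegral_infinitePi_prod_of_injOn {ι κ X : Type*} [MeasurableSpace X] (μ : Measure X)
    [IsProbabilityMeasure μ] (T : Finset ι) (e : ι → κ) (he : Set.InjOn e T) (F : ι → X → ℝ≥0∞)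
    (hF : ∀ j, Measurable (F j)) :
    ∫⁻ x, ∏ j ∈ T, F j (x (e j)) ∂(Measure.infinitePi fun _ : κ => μ) =
      ∏ j ∈ T, ∫⁻ b, F j b ∂μ := by
  set ν := Measure.infinitePi fun _ : κ => μ with hν
  have hind : iIndepFun (fun (j : κ) (x : κ → X) => x j) ν :=
    iIndepFun_infinitePi (X := fun _ x => x) (fun _ => measurable_id)
  have hind' : iIndepFun (fun (j : T) (x : κ → X) => F j (x (e j))) ν :=
    (hind.precomp (g := fun j : T => e j) fun a b hab => Subtype.ext (he a.2 b.2 hab)).comp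
      (fun j => F j) fun j => hF j
  have h := lintegral_prod_eq_prod_lintegral_of_indepFun (μ := ν) Finset.univ _ hind'
    (fun j => (hF j).comp (measurable_pi_apply (e j)))
  calc _ = ∫⁻ x, ∏ j : T, F j (x (e j)) ∂ν :=
        lintegral_congr fun x => (Finset.prod_coe_sort T fun j => F j (x (e j))).symm
    _ = ∏ j : T, ∫⁻ x, F j (x (e j)) ∂ν := h
    _ = ∏ j ∈ T, ∫⁻ x, F j (x (e j)) ∂ν := Finset.prod_coe_sort T fun j => ∫⁻ x, F j (x (e j)) ∂ν
    _ = _ := by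
        refine Finset.prod_congr rfl fun j _ => ?_
        have hmap : ν.map (fun x => x (e j)) = μ := Measure.infinitePi_map_eval (fun _ => μ) (e j)
        have hj : Measurable fun x : κ → X => x (e j) := measurable_pi_apply (e j)
        calc _ = ∫⁻ b, F j b ∂ν.map (fun x => x (e j)) := (lintegral_map (hF j) hj).symm
          _ = _ := by rw [hmap]

/-! ### The degree count as a sum of product indicators. -/

theorem measurable_torusDist {d : ℕ} {Ω : Type*} [MeasurableSpace Ω]
    {x y : Ω → EuclideanSpace ℝ (Fin d)} (hx : Measurable x) (hy : Measurable y) :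
    Measurable fun ω => torusDist (x ω) (y ω) := by
  unfold torusDist
  exact Measurable.iInf fun z => by fun_prop

theorem measurable_connProb {d : ℕ} (α η r : ℝ) {Ω : Type*} [MeasurableSpace Ω]
    {x y : Ω → EuclideanSpace ℝ (Fin d)} {w w' : Ω → ℝ} (hx : Measurable x) (hy : Measurable y)
    (hw : Measurable w) (hw' : Measurable w') :
    Measurable fun ω => connProb α η r (x ω) (w ω) (y ω) (w' ω) := by
  have h : Measurable fun ω => torusDist (x ω) (y ω) := measurable_torusDist hx hy
  unfold connProb
  fun_prop

theorem connProb_le_one {d : ℕ} (α η r : ℝ) (x : EuclideanSpace ℝ (Fin d)) (w : ℝ)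
    (y : EuclideanSpace ℝ (Fin d)) (w' : ℝ) : connProb α η r x w y w' ≤ 1 := by
  unfold connProb
  linarith [Real.exp_pos (-(η * w * w' / (torusDist x y / r) ^ α))]

/-- The locations, weights and pair variables of a sample. -/
abbrev Marks (d : ℕ) : Type :=
  (ℕ → EuclideanSpace ℝ (Fin d)) × (ℕ → ℝ) × (Sym2 ℕ → ℝ)

/-- The event that the points with labels `i` and `j` are joined. -/
def joined {d : ℕ} (α η r : ℝ) (i j : ℕ) : Set (Marks d) :=
  {y | y.2.2 s(i, j) < connProb α η r (y.1 i) (y.2.1 i) (y.1 j) (y.2.1 j)}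

theorem measurableSet_joined {d : ℕ} (α η r : ℝ) (i j : ℕ) :
    MeasurableSet (joined (d := d) α η r i j) := by
  refine measurableSet_lt (by fun_prop) (measurable_connProb α η r ?_ ?_ ?_ ?_) <;> fun_prop

/-- The indicator that, inside `T`, the neighbours of `i` are exactly the elements of `A`. -/
def neighborIndicator {d : ℕ} (α η r : ℝ) (i : ℕ) (T A : Finset ℕ) (y : Marks d) : ℝ≥0∞ :=
  ∏ j ∈ T, if j ∈ A then (joined α η r i j).indicator 1 y else (joined α η r i j)ᶜ.indicator 1 y

theorem measurable_neighborIndicator {d : ℕ} (α η r : ℝ) (i : ℕ) (T A : Finset ℕ) :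
    Measurable (neighborIndicator (d := d) α η r i T A) := by
  unfold neighborIndicator
  refine Finset.measurable_prod _ fun j _ => ?_
  split_ifs
  · exact measurable_one.indicator (measurableSet_joined α η r i j)
  · exact measurable_one.indicator (measurableSet_joined α η r i j).compl

open Classical in
-- Bridge between two forms of one event: the product factorises under independence, while the
-- equality of sets can be summed over `A` to count vertices by degree.
theorem neighborIndicator_eq {d : ℕ} (α η r : ℝ) (i : ℕ) (T A : Finset ℕ) (hA : A ⊆ T)
    (y : Marks d) :
    neighborIndicator α η r i T A y =
      if A = T.filter (fun j => y ∈ joined α η r i j) then 1 else 0 := by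
  unfold neighborIndicator
  split_ifs with h
  · refine Finset.prod_eq_one fun j hj => ?_
    split_ifs with hjA
    · rw [h, Finset.mem_filter] at hjA
      simp [hjA.2]
    · rw [h, Finset.mem_filter] at hjA
      simp [show y ∉ joined α η r i j from fun hy => hjA ⟨hj, hy⟩]
  · obtain ⟨j, hj, hne⟩ : ∃ j ∈ T, ¬(j ∈ A ↔ y ∈ joined α η r i j) := by
      by_contra! hcon
      refine h (Finset.ext fun j => ?_)
      rw [Finset.mem_filter]
      exact ⟨fun hjA => ⟨hA hjA, (hcon j (hA hjA)).1 hjA⟩, fun hj => (hcon j hj.1).2 hj.2⟩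
    refine Finset.prod_eq_zero hj ?_
    by_cases hjA : j ∈ A <;> by_cases hy : y ∈ joined α η r i j <;> simp_all

/-- The number of vertices of degree `k`, as a sum of indicators over vertices and over the
possible sets of neighbours. -/
theorem numDegree_eq_sum {d : ℕ} (α η r : ℝ) (k n : ℕ) (y : Marks d) :
    (numDegree α η r k (n, y) : ℝ≥0∞) =
      ∑ i ∈ Finset.range n, ∑ A ∈ ((Finset.range n).erase i).powersetCard k,
        neighborIndicator α η r i ((Finset.range n).erase i) A y := by
  classical
  have hdeg : ∀ i : Fin n, (graph α η r ((n, y) : Sample d)).degree i =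
      (((Finset.range n).erase i).filter fun j => y ∈ joined α η r i j).card := by
    intro i
    rw [← SimpleGraph.card_neighborFinset_eq_degree]
    refine Finset.card_bij (fun j _ => (j : ℕ)) ?_ ?_ ?_
    · intro j hj
      rw [SimpleGraph.mem_neighborFinset] at hj
      simp only [Finset.mem_filter, Finset.mem_erase, Finset.mem_range]
      exact ⟨⟨fun h => hj.1 (Fin.ext h.symm), j.2⟩, hj.2⟩
    · intro a _ b _ h
      exact Fin.ext h
    · intro b hb
      simp only [Finset.mem_filter, Finset.mem_erase, Finset.mem_range] at hb
      refine ⟨⟨b, hb.1.2⟩, ?_, rfl⟩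
      rw [SimpleGraph.mem_neighborFinset]
      exact ⟨fun h => hb.1.1 (by rw [h]), hb.2⟩
  -- Only the true neighbour set contributes, and it is among the summands exactly when it has `k`
  -- elements.
  have hsum : ∀ i : ℕ, ∑ A ∈ ((Finset.range n).erase i).powersetCard k,
        neighborIndicator α η r i ((Finset.range n).erase i) A y =
      if (((Finset.range n).erase i).filter fun j => y ∈ joined α η r i j).card = k
        then 1 else 0 := by
    intro i
    rw [Finset.sum_congr rfl fun A hA =>
      neighborIndicator_eq α η r i _ A (Finset.mem_powersetCard.1 hA).1 y]
    rw [Finset.sum_ite_eq']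
    simp [Finset.mem_powersetCard]
  rw [Finset.sum_congr rfl fun i _ => hsum i, Finset.sum_range fun i : ℕ =>
    if (((Finset.range n).erase i).filter fun j => y ∈ joined α η r i j).card = k
        then (1 : ℝ≥0∞) else 0]
  unfold numDegree
  rw [Finset.card_filter]
  push_cast
  refine Finset.sum_congr rfl fun i _ => ?_
  rw [← hdeg i]

theorem measurable_numDegree {d : ℕ} (α η r : ℝ) (k : ℕ) :
    Measurable fun ω : Sample d => (numDegree α η r k ω : ℝ≥0∞) := by
  refine measurable_from_prod_countable_right fun n => ?_
  simp_rw [numDegree_eq_sum]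
  exact Finset.measurable_sum _ fun i _ => Finset.measurable_sum _ fun A _ =>
    measurable_neighborIndicator α η r i _ A

/-! ### Averaging over pair variables, weights and locations for a fixed number of points. -/

/-- The mean, over a uniform location and a Pareto weight, of the probability of being joined to a
point at `x` with weight `w`. -/
def connMass (d : ℕ) (α β η r : ℝ) (x : EuclideanSpace ℝ (Fin d)) (w : ℝ) : ℝ≥0∞ :=
  ∫⁻ y in cube d, ∫⁻ w', ENNReal.ofReal (connProb α η r x w y w') ∂(paretoMeasure 1 β)

/-- The joint law of the locations, the weights and the pair variables. -/
def markLaw (d : ℕ) (β : ℝ) : Measure (Marks d) :=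
  (Measure.infinitePi fun _ : ℕ => volume.restrict (cube d)).prod
    ((Measure.infinitePi fun _ : ℕ => paretoMeasure 1 β).prod
      (Measure.infinitePi fun _ : Sym2 ℕ => volume.restrict (Set.Icc (0 : ℝ) 1)))

instance isProbabilityMeasure_volume_cube (d : ℕ) :
    IsProbabilityMeasure (volume.restrict (cube d)) := ⟨by simp [volume_cube]⟩

instance isProbabilityMeasure_volume_Icc :
    IsProbabilityMeasure (volume.restrict (Set.Icc (0 : ℝ) 1)) := ⟨by simp⟩

/-- For negative `p` both sides vanish, so no lower bound on `p` is needed. -/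
theorem uniform_Iio {p : ℝ} (hp : p ≤ 1) :
    volume.restrict (Set.Icc (0 : ℝ) 1) (Set.Iio p) = ENNReal.ofReal p := by
  rw [Measure.restrict_apply measurableSet_Iio]
  have h : Set.Iio p ∩ Set.Icc (0 : ℝ) 1 = Set.Ico 0 p := by
    ext u
    simp only [Set.mem_inter_iff, Set.mem_Iio, Set.mem_Icc, Set.mem_Ico]
    constructor
    · rintro ⟨h1, h2, -⟩
      exact ⟨h2, h1⟩
    · rintro ⟨h1, h2⟩
      exact ⟨h2, h1, by linarith⟩
  rw [h, Real.volume_Ico, sub_zero]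

theorem lintegral_ite_one_sub {X : Type*} [MeasurableSpace X] (μ : Measure X)
    [IsProbabilityMeasure μ] (b : Prop) [Decidable b] {f : X → ℝ≥0∞} (hf : Measurable f)
    (hf1 : ∀ x, f x ≤ 1) :
    (∫⁻ x, if b then f x else 1 - f x ∂μ) = if b then ∫⁻ x, f x ∂μ else 1 - ∫⁻ x, f x ∂μ := by
  split_ifs
  · rfl
  · have hle : ∫⁻ x, f x ∂μ ≤ 1 := by
      calc ∫⁻ x, f x ∂μ ≤ ∫⁻ _, 1 ∂μ := lintegral_mono hf1
        _ = 1 := by simp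
    rw [lintegral_sub hf (ne_top_of_le_ne_top ENNReal.one_ne_top hle)
      (Eventually.of_forall hf1)]
    simp

/-- For fixed `i` the unordered pairs `s(i, j)` are distinct, so the edges at `i` depend on
different, independent uniform variables. -/
theorem lintegral_neighborIndicator_pairs {d : ℕ} (α η r : ℝ) (i : ℕ) (T A : Finset ℕ)
    (x : ℕ → EuclideanSpace ℝ (Fin d)) (w : ℕ → ℝ) :
    ∫⁻ u, neighborIndicator α η r i T A (x, w, u)
        ∂(Measure.infinitePi fun _ : Sym2 ℕ => volume.restrict (Set.Icc (0 : ℝ) 1)) =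
      ∏ j ∈ T, if j ∈ A then ENNReal.ofReal (connProb α η r (x i) (w i) (x j) (w j))
        else 1 - ENNReal.ofReal (connProb α η r (x i) (w i) (x j) (w j)) := by
  set p : ℕ → ℝ := fun j => connProb α η r (x i) (w i) (x j) (w j) with hp
  have h := lintegral_infinitePi_prod_of_injOn (volume.restrict (Set.Icc (0 : ℝ) 1)) T
    (fun j => s(i, j)) (fun a _ b _ hab => Sym2.congr_right.1 hab)
    (fun j => if j ∈ A then (Set.Iio (p j)).indicator 1 else (Set.Iio (p j))ᶜ.indicator 1)
    (fun j => by
      split_ifs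
      · exact measurable_one.indicator measurableSet_Iio
      · exact measurable_one.indicator measurableSet_Iio.compl)
  calc _ = _ := by
        refine lintegral_congr fun u => ?_
        unfold neighborIndicator
        refine Finset.prod_congr rfl fun j _ => ?_
        split_ifs <;> rfl
    _ = _ := h
    _ = _ := by
        refine Finset.prod_congr rfl fun j _ => ?_
        split_ifs
        · rw [lintegral_indicator_one measurableSet_Iio, uniform_Iio (connProb_le_one ..)]
        · rw [lintegral_indicator_one measurableSet_Iio.compl,
            prob_compl_eq_one_sub measurableSet_Iio, uniform_Iio (connProb_le_one ..)]

theorem measurable_lintegral_connProb {d : ℕ} {α β η r : ℝ} (hβ : 0 < β) {Ω : Type*}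
    [MeasurableSpace Ω] {x y : Ω → EuclideanSpace ℝ (Fin d)} {w : Ω → ℝ} (hx : Measurable x)
    (hw : Measurable w) (hy : Measurable y) :
    Measurable fun ω =>
      ∫⁻ w', ENNReal.ofReal (connProb α η r (x ω) (w ω) (y ω) w') ∂(paretoMeasure 1 β) := by
  have : IsProbabilityMeasure (paretoMeasure 1 β) :=
    isProbabilityMeasure_paretoMeasure one_pos hβ
  refine Measurable.lintegral_prod_right' (f := fun q : Ω × ℝ =>
    ENNReal.ofReal (connProb α η r (x q.1) (w q.1) (y q.1) q.2)) ?_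
  exact (measurable_connProb α η r (by fun_prop) (by fun_prop) (by fun_prop)
    (by fun_prop)).ennreal_ofReal

theorem measurable_connMass {d : ℕ} {α β η r : ℝ} (hβ : 0 < β) (x : EuclideanSpace ℝ (Fin d)) :
    Measurable fun w => connMass d α β η r x w := by
  refine Measurable.lintegral_prod_right' (f := fun q : ℝ × EuclideanSpace ℝ (Fin d) =>
    ∫⁻ w', ENNReal.ofReal (connProb α η r x q.1 q.2 w') ∂(paretoMeasure 1 β)) ?_
  exact measurable_lintegral_connProb hβ measurable_const measurable_fst measurable_snd

theorem lintegral_connProb_le_one {d : ℕ} {α β η r : ℝ} (hβ : 0 < β)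
    (x : EuclideanSpace ℝ (Fin d)) (w : ℝ) (y : EuclideanSpace ℝ (Fin d)) :
    ∫⁻ w', ENNReal.ofReal (connProb α η r x w y w') ∂(paretoMeasure 1 β) ≤ 1 := by
  have : IsProbabilityMeasure (paretoMeasure 1 β) :=
    isProbabilityMeasure_paretoMeasure one_pos hβ
  calc _ ≤ ∫⁻ _, 1 ∂(paretoMeasure 1 β) :=
        lintegral_mono fun w' => ENNReal.ofReal_le_one.2 (connProb_le_one ..)
    _ = 1 := by simp

theorem connMass_le_one {d : ℕ} {α β η r : ℝ} (hβ : 0 < β)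
    (x : EuclideanSpace ℝ (Fin d)) (w : ℝ) : connMass d α β η r x w ≤ 1 := by
  calc _ ≤ ∫⁻ _ in cube d, 1 := lintegral_mono fun y => lintegral_connProb_le_one hβ x w y
    _ = 1 := by simp

theorem lintegral_neighborIndicator_weights {d : ℕ} {α β η r : ℝ} (hβ : 0 < β) (i : ℕ)
    (T A : Finset ℕ) (hi : i ∉ T) (x : ℕ → EuclideanSpace ℝ (Fin d)) :
    (∫⁻ w, ∏ j ∈ T, (if j ∈ A then ENNReal.ofReal (connProb α η r (x i) (w i) (x j) (w j))
        else 1 - ENNReal.ofReal (connProb α η r (x i) (w i) (x j) (w j)))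
        ∂(Measure.infinitePi fun _ : ℕ => paretoMeasure 1 β)) =
      ∫⁻ a, ∏ j ∈ T, (if j ∈ A then
          ∫⁻ b, ENNReal.ofReal (connProb α η r (x i) a (x j) b) ∂(paretoMeasure 1 β)
        else 1 - ∫⁻ b, ENNReal.ofReal (connProb α η r (x i) a (x j) b) ∂(paretoMeasure 1 β))
        ∂(paretoMeasure 1 β) := by
  have : IsProbabilityMeasure (paretoMeasure 1 β) :=
    isProbabilityMeasure_paretoMeasure one_pos hβ
  have hm : ∀ j, Measurable fun q : ℝ × ℝ =>
      ENNReal.ofReal (connProb α η r (x i) q.1 (x j) q.2) := fun j =>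
    (measurable_connProb α η r measurable_const measurable_const measurable_fst
      measurable_snd).ennreal_ofReal
  rw [lintegral_infinitePi_prod_pair (paretoMeasure 1 β) i T hi (fun j a b =>
    if j ∈ A then ENNReal.ofReal (connProb α η r (x i) a (x j) b)
      else 1 - ENNReal.ofReal (connProb α η r (x i) a (x j) b)) ?_]
  · refine lintegral_congr fun a => Finset.prod_congr rfl fun j _ => ?_
    exact lintegral_ite_one_sub _ _ (measurable_connProb α η r measurable_const measurable_const
      measurable_const measurable_id).ennreal_ofReal
      fun b => ENNReal.ofReal_le_one.2 (connProb_le_one ..)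
  · intro j
    by_cases hj : j ∈ A
    · simp only [hj, if_true]
      exact hm j
    · simp only [hj, if_false]
      exact measurable_const.sub (hm j)

theorem lintegral_neighborIndicator_locations {d : ℕ} {α β η r : ℝ} (hβ : 0 < β) (i : ℕ)
    (T A : Finset ℕ) (hi : i ∉ T) (a : ℝ) :
    (∫⁻ x, ∏ j ∈ T, (if j ∈ A then
          ∫⁻ b, ENNReal.ofReal (connProb α η r (x i) a (x j) b) ∂(paretoMeasure 1 β)
        else 1 - ∫⁻ b, ENNReal.ofReal (connProb α η r (x i) a (x j) b) ∂(paretoMeasure 1 β))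
        ∂(Measure.infinitePi fun _ : ℕ => volume.restrict (cube d))) =
      ∫⁻ z in cube d, ∏ j ∈ T, (if j ∈ A then connMass d α β η r z a
        else 1 - connMass d α β η r z a) := by
  have hm : Measurable fun q : EuclideanSpace ℝ (Fin d) × EuclideanSpace ℝ (Fin d) =>
      ∫⁻ b, ENNReal.ofReal (connProb α η r q.1 a q.2 b) ∂(paretoMeasure 1 β) :=
    measurable_lintegral_connProb hβ measurable_fst measurable_const measurable_snd
  rw [lintegral_infinitePi_prod_pair (volume.restrict (cube d)) i T hi (fun j y z =>
    if j ∈ A then ∫⁻ b, ENNReal.ofReal (connProb α η r y a z b) ∂(paretoMeasure 1 β)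
      else 1 - ∫⁻ b, ENNReal.ofReal (connProb α η r y a z b) ∂(paretoMeasure 1 β)) ?_]
  · refine lintegral_congr fun z => Finset.prod_congr rfl fun j _ => ?_
    exact lintegral_ite_one_sub _ _
      (measurable_lintegral_connProb hβ measurable_const measurable_const measurable_id)
      fun y => lintegral_connProb_le_one hβ z a y
  · intro j
    by_cases hj : j ∈ A
    · simp only [hj, if_true]
      exact hm
    · simp only [hj, if_false]
      exact measurable_const.sub hm

/-- The pair variables are integrated out first, then the weights of the other points, then (after a
Tonelli swap with the weight of `i`) the locations. By `hL` the resulting factors do not depend on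
the location of `i`, which leaves a binomial term. -/
theorem lintegral_neighborIndicator {d : ℕ} {α β η r : ℝ} (hβ : 0 < β)
    (hL : ∀ x w, connMass d α β η r x w = connMass d α β η r 0 w) (i : ℕ)
    (T A : Finset ℕ) (hi : i ∉ T) (hA : A ⊆ T) :
    ∫⁻ y, neighborIndicator α η r i T A y ∂(markLaw d β) =
      ∫⁻ a, connMass d α β η r 0 a ^ A.card * (1 - connMass d α β η r 0 a) ^ (T.card - A.card)
        ∂(paretoMeasure 1 β) := by
  have : IsProbabilityMeasure (paretoMeasure 1 β) :=
    isProbabilityMeasure_paretoMeasure one_pos hβ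
  have hmeas := measurable_neighborIndicator (d := d) α η r i T A
  have hmeas2 : Measurable fun p : (ℕ → EuclideanSpace ℝ (Fin d)) × ℝ => ∏ j ∈ T, (if j ∈ A then
          ∫⁻ b, ENNReal.ofReal (connProb α η r (p.1 i) p.2 (p.1 j) b) ∂(paretoMeasure 1 β)
        else 1 - ∫⁻ b, ENNReal.ofReal (connProb α η r (p.1 i) p.2 (p.1 j) b)
          ∂(paretoMeasure 1 β)) := by
    refine Finset.measurable_prod _ fun j _ => ?_
    have hm : Measurable fun p : (ℕ → EuclideanSpace ℝ (Fin d)) × ℝ =>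
        ∫⁻ b, ENNReal.ofReal (connProb α η r (p.1 i) p.2 (p.1 j) b) ∂(paretoMeasure 1 β) :=
      measurable_lintegral_connProb hβ (by fun_prop) (by fun_prop) (by fun_prop)
    split_ifs
    · exact hm
    · exact measurable_const.sub hm
  unfold markLaw
  rw [lintegral_prod _ hmeas.aemeasurable]
  calc _ = ∫⁻ x, ∫⁻ w, ∏ j ∈ T, (if j ∈ A then
          ENNReal.ofReal (connProb α η r (x i) (w i) (x j) (w j))
        else 1 - ENNReal.ofReal (connProb α η r (x i) (w i) (x j) (w j)))
        ∂(Measure.infinitePi fun _ : ℕ => paretoMeasure 1 β)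
        ∂(Measure.infinitePi fun _ : ℕ => volume.restrict (cube d)) := by
        refine lintegral_congr fun x => ?_
        have hx : Measurable fun y => neighborIndicator α η r i T A (x, y) :=
          hmeas.comp measurable_prodMk_left
        rw [lintegral_prod _ hx.aemeasurable]
        exact lintegral_congr fun w => lintegral_neighborIndicator_pairs α η r i T A x w
    _ = ∫⁻ a, ∫⁻ x, ∏ j ∈ T, (if j ∈ A then
          ∫⁻ b, ENNReal.ofReal (connProb α η r (x i) a (x j) b) ∂(paretoMeasure 1 β)
        else 1 - ∫⁻ b, ENNReal.ofReal (connProb α η r (x i) a (x j) b) ∂(paretoMeasure 1 β))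
        ∂(Measure.infinitePi fun _ : ℕ => volume.restrict (cube d)) ∂(paretoMeasure 1 β) := by
        rw [lintegral_congr fun x => lintegral_neighborIndicator_weights hβ i T A hi x]
        exact lintegral_lintegral_swap hmeas2.aemeasurable
    _ = _ := by
        refine lintegral_congr fun a => ?_
        rw [lintegral_neighborIndicator_locations hβ i T A hi a]
        simp_rw [hL _ a]
        rw [lintegral_const, measure_univ, mul_one, Finset.prod_ite, Finset.prod_const,
          Finset.prod_const, Finset.filter_mem_eq_inter, Finset.inter_eq_right.2 hA]
        congr 2
        rw [Finset.filter_notMem_eq_sdiff, Finset.card_sdiff_of_subset hA]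

/-- By exchangeability all vertices and all `k`-element neighbour sets contribute equally. For `n =
0` the truncated `n - 1` is harmless because of the factor `n`. -/
theorem lintegral_numDegree_markLaw {d : ℕ} {α β η r : ℝ} (hβ : 0 < β)
    (hL : ∀ x w, connMass d α β η r x w = connMass d α β η r 0 w) (k n : ℕ) :
    ∫⁻ y, (numDegree α η r k ((n, y) : Sample d) : ℝ≥0∞) ∂(markLaw d β) =
      n * (n - 1).choose k * ∫⁻ a, connMass d α β η r 0 a ^ k *
        (1 - connMass d α β η r 0 a) ^ (n - 1 - k) ∂(paretoMeasure 1 β) := by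
  simp_rw [numDegree_eq_sum]
  rw [lintegral_finsetSum _ fun i _ => Finset.measurable_sum _ fun A _ =>
    measurable_neighborIndicator α η r i _ A]
  have h : ∀ i ∈ Finset.range n,
      ∫⁻ y, ∑ A ∈ ((Finset.range n).erase i).powersetCard k,
        neighborIndicator α η r i ((Finset.range n).erase i) A y ∂(markLaw d β) =
      (n - 1).choose k * ∫⁻ a, connMass d α β η r 0 a ^ k *
        (1 - connMass d α β η r 0 a) ^ (n - 1 - k) ∂(paretoMeasure 1 β) := by
    intro i hi
    have hcard : ((Finset.range n).erase i).card = n - 1 := by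
      rw [Finset.card_erase_of_mem hi, Finset.card_range]
    rw [lintegral_finsetSum _ fun A _ => measurable_neighborIndicator α η r i _ A]
    rw [Finset.sum_congr rfl fun A hA => by
      rw [lintegral_neighborIndicator hβ hL i _ A (Finset.notMem_erase i _)
        (Finset.mem_powersetCard.1 hA).1, hcard, (Finset.mem_powersetCard.1 hA).2]]
    rw [Finset.sum_const, Finset.card_powersetCard, hcard, nsmul_eq_mul]
  rw [Finset.sum_congr rfl h, Finset.sum_const, Finset.card_range, nsmul_eq_mul, mul_assoc]

/-! ### Poisson summation and the Mecke formula. -/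

/-- Poisson thinning: the terms with `n ≤ k` vanish, and shifting by `k + 1` (the vertex and its
neighbours) leaves the exponential series of `s * (1 - l)`. -/
theorem hasSum_poisson_degree (k : ℕ) (s l : ℝ) :
    HasSum (fun n : ℕ => Real.exp (-s) * s ^ n / n.factorial *
        (n * (n - 1).choose k * (l ^ k * (1 - l) ^ (n - 1 - k))))
      (s * ((s * l) ^ k / k.factorial * Real.exp (-(s * l)))) := by
  have hz : ∀ n ∈ Finset.range (k + 1), Real.exp (-s) * s ^ n / n.factorial *
        (n * (n - 1).choose k * (l ^ k * (1 - l) ^ (n - 1 - k))) = 0 := by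
    intro n hn
    rw [Finset.mem_range] at hn
    rcases Nat.eq_zero_or_pos n with rfl | hpos
    · simp
    · rw [Nat.choose_eq_zero_of_lt (by omega : n - 1 < k)]
      simp
  rw [← hasSum_nat_add_iff' (k + 1), Finset.sum_eq_zero hz, sub_zero]
  have h := (NormedSpace.expSeries_div_hasSum_exp (𝔸 := ℝ) (s * (1 - l))).mul_left
    (Real.exp (-s) * (s * ((s * l) ^ k / k.factorial)))
  rw [← Real.exp_eq_exp_ℝ] at h
  convert! h using 1
  · ext j
    have h1 : j + (k + 1) - 1 = j + k := by omega
    have h2 : j + k - k = j := by omega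
    have h3 : ((j + k).choose k : ℝ) = (j + k).factorial / (k.factorial * j.factorial) := by
      rw [Nat.cast_choose ℝ (Nat.le_add_left k j), h2]
    have h4 : ((j + (k + 1)).factorial : ℝ) = (j + k + 1 : ℝ) * (j + k).factorial := by
      rw [← add_assoc, Nat.factorial_succ]
      push_cast
      ring
    rw [h1, h2, h3, h4, mul_pow s (1 - l) j]
    push_cast
    have : (j + k + 1 : ℝ) ≠ 0 := by positivity
    have : ((j + k).factorial : ℝ) ≠ 0 := by positivity
    field_simp
    ring
  · rw [mul_right_comm, ← Real.exp_add]
    ring_nf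

theorem lintegral_poissonMeasure (s : NNReal) (f : ℕ → ℝ≥0∞) :
    ∫⁻ n, f n ∂(poissonMeasure s) =
      ∑' n : ℕ, ENNReal.ofReal (Real.exp (-s) * (s : ℝ) ^ n / n.factorial) * f n := by
  rw [poissonMeasure, lintegral_sum_measure]
  refine tsum_congr fun n => ?_
  rw [lintegral_smul_measure, lintegral_dirac, smul_eq_mul]

/-- The Mecke formula for the expected number of vertices of degree `k`. -/
theorem lintegral_numDegree {d : ℕ} {α β η r s : ℝ} (hβ : 0 < β) (hs : 0 < s)
    (hL : ∀ x w, connMass d α β η r x w = connMass d α β η r 0 w) (k : ℕ) :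
    ∫⁻ ω, (numDegree α η r k ω : ℝ≥0∞) ∂(law d β s) =
      ∫⁻ a, ENNReal.ofReal (s * ((s * (connMass d α β η r 0 a).toReal) ^ k / k.factorial *
        Real.exp (-(s * (connMass d α β η r 0 a).toReal)))) ∂(paretoMeasure 1 β) := by
  have : IsProbabilityMeasure (paretoMeasure 1 β) :=
    isProbabilityMeasure_paretoMeasure one_pos hβ
  have : SFinite (markLaw d β) := by unfold markLaw; infer_instance
  have hlaw : law d β s = (poissonMeasure s.toNNReal).prod (markLaw d β) := rfl
  have hLm : Measurable fun a => connMass d α β η r 0 a := measurable_connMass hβ 0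
  rw [hlaw, lintegral_prod _ (measurable_numDegree α η r k).aemeasurable,
    lintegral_poissonMeasure]
  simp_rw [lintegral_numDegree_markLaw hβ hL k, Real.coe_toNNReal s hs.le]
  have hm : ∀ n : ℕ, Measurable fun a => connMass d α β η r 0 a ^ k *
        (1 - connMass d α β η r 0 a) ^ (n - 1 - k) := fun n =>
    (hLm.pow_const k).mul ((measurable_const.sub hLm).pow_const _)
  have hm' : ∀ n : ℕ, Measurable fun a => (n * (n - 1).choose k : ℝ≥0∞) *
      (connMass d α β η r 0 a ^ k * (1 - connMass d α β η r 0 a) ^ (n - 1 - k)) :=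
    fun n => (hm n).const_mul _
  simp_rw [← lintegral_const_mul _ (hm _), ← lintegral_const_mul _ (hm' _)]
  rw [← lintegral_tsum fun n => ((hm' n).const_mul _).aemeasurable]
  refine lintegral_congr fun a => ?_
  set L := connMass d α β η r 0 a with hLdef
  -- This bound makes the truncated `1 - L` in `ℝ≥0∞` agree with real subtraction.
  have hL1 : L ≤ 1 := connMass_le_one hβ 0 a
  have hLtop : L ≠ ∞ := ne_top_of_le_ne_top ENNReal.one_ne_top hL1
  have hl0 : 0 ≤ L.toReal := ENNReal.toReal_nonneg
  have hl1 : 0 ≤ 1 - L.toReal := by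
    have := ENNReal.toReal_mono ENNReal.one_ne_top hL1
    simp only [ENNReal.toReal_one] at this
    linarith
  have hsum := hasSum_poisson_degree k s L.toReal
  rw [← hsum.tsum_eq, ENNReal.ofReal_tsum_of_nonneg (fun n => by positivity) hsum.summable]
  refine tsum_congr fun n => ?_
  rw [ENNReal.ofReal_mul (by positivity), ENNReal.ofReal_mul (by positivity),
    ENNReal.ofReal_mul (by positivity), ENNReal.ofReal_mul (by positivity),
    ENNReal.ofReal_natCast, ENNReal.ofReal_natCast, ENNReal.ofReal_pow hl0,
    ENNReal.ofReal_pow hl1, ENNReal.ofReal_toReal hLtop, ENNReal.ofReal_sub _ hl0,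
    ENNReal.ofReal_one, ENNReal.ofReal_toReal hLtop]

/-! ### Homogeneity of the torus. -/

/-- The lattice `ℤ^d`, as an additive subgroup of Euclidean space. -/
def intLattice (d : ℕ) : AddSubgroup (EuclideanSpace ℝ (Fin d)) :=
  AddMonoidHom.range (G := Fin d → ℤ)
    { toFun := fun z => WithLp.toLp 2 (fun i => (z i : ℝ))
      map_zero' := by ext i; simp
      map_add' := fun a b => by ext i; simp }

theorem mem_intLattice {d : ℕ} {x : EuclideanSpace ℝ (Fin d)} :
    x ∈ intLattice d ↔ ∃ z : Fin d → ℤ, WithLp.toLp 2 (fun i => (z i : ℝ)) = x := Iff.rfl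

instance countable_intLattice (d : ℕ) : Countable (intLattice d) := by
  unfold intLattice
  exact (Set.countable_range _).to_subtype

theorem measurableSet_cube (d : ℕ) : MeasurableSet (cube d) := by
  have h : cube d = ⋂ i, (fun x : EuclideanSpace ℝ (Fin d) => x i) ⁻¹'
      Set.Ioc (-1 / 2 : ℝ) (1 / 2) := by
    ext x
    simp [cube]
  rw [h]
  exact MeasurableSet.iInter fun i => (by fun_prop : Measurable
    fun x : EuclideanSpace ℝ (Fin d) => x i) measurableSet_Ioc

theorem measurePreserving_const_sub {d : ℕ} (x : EuclideanSpace ℝ (Fin d)) :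
    MeasurePreserving (fun v => x - v) volume volume :=
  Measure.measurePreserving_sub_left volume x

/-- Every reflected translate of the cube is a fundamental domain of the lattice `ℤ^d`. -/
theorem isAddFundamentalDomain_reflected_cube {d : ℕ} (x : EuclideanSpace ℝ (Fin d)) :
    IsAddFundamentalDomain (intLattice d) ((fun v => x - v) ⁻¹' cube d) volume := by
  refine IsAddFundamentalDomain.mk'
    ((measurePreserving_const_sub x).measurable (measurableSet_cube d)).nullMeasurableSet ?_
  intro v
  -- In each coordinate exactly one integer shift lands in the half-open unit interval.
  have hu := fun i => existsUnique_sub_zsmul_mem_Ioc (one_pos : (0 : ℝ) < 1) (x i - v i) (-1 / 2)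
  choose z hz hzu using hu
  have hend : (-1 / 2 + 1 : ℝ) = 1 / 2 := by norm_num
  refine ⟨⟨WithLp.toLp 2 (fun i => (z i : ℝ)), mem_intLattice.2 ⟨z, rfl⟩⟩, ?_, ?_⟩
  · intro i
    have h := hz i
    simp only [hend, zsmul_eq_mul, mul_one] at h
    change (x i - ((z i : ℝ) + v i)) ∈ _
    rwa [← sub_sub, sub_right_comm]
  · rintro ⟨g, hg⟩ hgv
    obtain ⟨z', rfl⟩ := mem_intLattice.1 hg
    have : z' = z := by
      ext i
      refine hzu i (z' i) ?_
      have h : (x i - ((z' i : ℝ) + v i)) ∈ Set.Ioc (-1 / 2 : ℝ) (1 / 2) := hgv i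
      simp only [hend, zsmul_eq_mul, mul_one]
      rwa [sub_right_comm, sub_sub]
    subst this
    rfl

theorem torusDist_add_left {d : ℕ} (x y : EuclideanSpace ℝ (Fin d)) (g : intLattice d) :
    torusDist (g +ᵥ x) y = torusDist x y := by
  obtain ⟨z, hz⟩ := mem_intLattice.1 g.2
  have hg : g +ᵥ x = WithLp.toLp 2 (fun i => (z i : ℝ)) + x := by rw [hz]; rfl
  unfold torusDist
  rw [hg]
  refine (Equiv.subRight z).iInf_congr fun z' => ?_
  congr 1
  ext i
  simp
  ring

theorem torusDist_self_sub {d : ℕ} (x v : EuclideanSpace ℝ (Fin d)) :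
    torusDist x (x - v) = torusDist v 0 := by
  unfold torusDist
  simp

/-- The shift `z = 0` is optimal coordinate by coordinate, since each coordinate of `y` has absolute
value at most 1/2. -/
theorem torusDist_zero_of_mem_cube {d : ℕ} {y : EuclideanSpace ℝ (Fin d)} (hy : y ∈ cube d) :
    torusDist 0 y = ‖y‖ := by
  have hb : BddBelow (Set.range fun z : Fin d → ℤ =>
      ‖0 - y - WithLp.toLp 2 (fun i => (z i : ℝ))‖) :=
    ⟨0, by rintro _ ⟨z, rfl⟩; exact norm_nonneg _⟩
  refine le_antisymm ?_ ?_
  · refine (ciInf_le hb 0).trans (le_of_eq ?_)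
    rw [← norm_neg]
    congr 1
    ext i
    simp
  · refine le_ciInf fun z => ?_
    rw [EuclideanSpace.norm_eq, EuclideanSpace.norm_eq]
    refine Real.sqrt_le_sqrt (Finset.sum_le_sum fun i _ => ?_)
    have h1 := hy i
    simp only [Real.norm_eq_abs, sq_abs, PiLp.sub_apply, zero_sub, PiLp.neg_apply]
    rcases lt_trichotomy (z i) 0 with h | h | h
    · have : (z i : ℝ) ≤ -1 := by exact_mod_cast Int.le_sub_one_of_lt h
      nlinarith [h1.1, h1.2]
    · simp [h]
    · have : (1 : ℝ) ≤ z i := by exact_mod_cast h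
      nlinarith [h1.1, h1.2]

/-- The torus is homogeneous: the integral of a function of the distance to a point does not
depend on the point. -/
theorem setLIntegral_torusDist {d : ℕ} (f : ℝ → ℝ≥0∞) (hf : Measurable f)
    (x : EuclideanSpace ℝ (Fin d)) :
    ∫⁻ y in cube d, f (torusDist x y) = ∫⁻ y in cube d, f ‖y‖ := by
  have key : ∀ x : EuclideanSpace ℝ (Fin d), ∫⁻ y in cube d, f (torusDist x y) =
      ∫⁻ v in (fun v => x - v) ⁻¹' cube d, f (torusDist v 0) := by
    intro x
    have hm : Measurable fun y => f (torusDist x y) :=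
      hf.comp (measurable_torusDist measurable_const measurable_id)
    rw [← (measurePreserving_const_sub x).setLIntegral_comp_preimage (measurableSet_cube d) hm]
    simp_rw [torusDist_self_sub]
  -- After `v = x - y` the integrand is lattice-periodic and only the domain depends on `x`; two
  -- fundamental domains give the same integral.
  rw [key x, (isAddFundamentalDomain_reflected_cube x).setLIntegral_eq
    (isAddFundamentalDomain_reflected_cube 0) _ (fun g v => by rw [torusDist_add_left]), ← key 0]
  exact setLIntegral_congr_fun (measurableSet_cube d)
    fun y hy => by rw [torusDist_zero_of_mem_cube hy]

theorem connMass_eq {d : ℕ} {α β η r : ℝ} (hβ : 0 < β) (x : EuclideanSpace ℝ (Fin d)) (w : ℝ) :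
    connMass d α β η r x w = ∫⁻ w', (∫⁻ y in cube d,
      ENNReal.ofReal (1 - Real.exp (-(η * w * w' / (‖y‖ / r) ^ α)))) ∂(paretoMeasure 1 β) := by
  have : IsProbabilityMeasure (paretoMeasure 1 β) :=
    isProbabilityMeasure_paretoMeasure one_pos hβ
  unfold connMass connProb
  have hm : Measurable fun p : ℝ × ℝ =>
      ENNReal.ofReal (1 - Real.exp (-(η * w * p.2 / (p.1 / r) ^ α))) := by fun_prop
  rw [setLIntegral_torusDist (fun t => ∫⁻ w', ENNReal.ofReal
    (1 - Real.exp (-(η * w * w' / (t / r) ^ α))) ∂(paretoMeasure 1 β)) hm.lintegral_prod_right' x]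
  refine lintegral_lintegral_swap (Measurable.aemeasurable ?_)
  unfold Function.uncurry
  fun_prop

theorem connMass_eq_zero_left {d : ℕ} {α β η r : ℝ} (hβ : 0 < β)
    (x : EuclideanSpace ℝ (Fin d)) (w : ℝ) :
    connMass d α β η r x w = connMass d α β η r 0 w := by
  rw [connMass_eq hβ x, connMass_eq hβ 0]

/-! ### Pareto moments and the connection mass. -/

theorem lintegral_paretoMeasure (β : ℝ) {f : ℝ → ℝ≥0∞} (hf : Measurable f) :
    ∫⁻ w, f w ∂(paretoMeasure 1 β) =
      ∫⁻ w in Set.Ioi 1, ENNReal.ofReal (β * w ^ (-(β + 1))) * f w := by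
  have hm : Measurable (paretoPDF 1 β) := (measurable_paretoPDFReal 1 β).ennreal_ofReal
  rw [paretoMeasure, lintegral_withDensity_eq_lintegral_mul _ hm hf,
    setLIntegral_congr Ioi_ae_eq_Ici, ← lintegral_indicator measurableSet_Ici]
  refine lintegral_congr fun w => ?_
  by_cases hw : (1 : ℝ) ≤ w
  · rw [Set.indicator_of_mem (Set.mem_Ici.2 hw), Pi.mul_apply, paretoPDF_of_le hw]
    simp
  · rw [Set.indicator_of_notMem (by simpa using hw), Pi.mul_apply,
      paretoPDF_of_lt (not_le.1 hw), zero_mul]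

theorem ae_one_le_paretoMeasure (β : ℝ) : ∀ᵐ w ∂(paretoMeasure 1 β), 1 ≤ w := by
  have hm : Measurable (paretoPDF 1 β) := (measurable_paretoPDFReal 1 β).ennreal_ofReal
  rw [paretoMeasure, ae_withDensity_iff hm]
  refine Eventually.of_forall fun w hw => ?_
  by_contra h
  exact hw (paretoPDF_of_lt (not_le.1 h))

theorem lintegral_rpow_paretoMeasure {β p : ℝ} (hβ : 0 < β) (hp : p < β) :
    ∫⁻ w, ENNReal.ofReal (w ^ p) ∂(paretoMeasure 1 β) = ENNReal.ofReal (β / (β - p)) := by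
  rw [lintegral_paretoMeasure β (by fun_prop)]
  have hexp : -(β + 1) + p < -1 := by linarith
  have hint := (integrableOn_Ioi_rpow_of_lt hexp one_pos).const_mul β
  calc _ = ∫⁻ w in Set.Ioi 1, ENNReal.ofReal (β * w ^ (-(β + 1) + p)) := by
        refine setLIntegral_congr_fun measurableSet_Ioi fun w hw => ?_
        have hw0 : (0 : ℝ) < w := lt_trans one_pos hw
        rw [← ENNReal.ofReal_mul (by positivity), mul_assoc, ← Real.rpow_add hw0]
    _ = _ := by
        rw [← ofReal_integral_eq_lintegral_ofReal hint]
        · rw [integral_const_mul, integral_Ioi_rpow_of_lt hexp one_pos, Real.one_rpow]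
          congr 1
          have h1 : β - p ≠ 0 := by linarith
          have h2 : -(β + 1) + p + 1 ≠ 0 := by
            intro h
            exact h1 (by linarith)
          field_simp
          ring
        · refine (ae_restrict_iff' measurableSet_Ioi).2 (Eventually.of_forall fun w hw => ?_)
          have hw0 : (0 : ℝ) < w := lt_trans one_pos hw
          simp only [Pi.zero_apply]
          positivity

/-- Layer-cake form: with `a` a function of the location, Tonelli reduces the spatial integral to
volumes of superlevel sets. -/
theorem ofReal_one_sub_exp_neg {a : ℝ} (ha : 0 ≤ a) :
    ENNReal.ofReal (1 - Real.exp (-a)) =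
      ∫⁻ t in Set.Ioi 0, (Set.Iio a).indicator (fun t => ENNReal.ofReal (Real.exp (-t))) t := by
  rw [lintegral_indicator measurableSet_Iio, Measure.restrict_restrict measurableSet_Iio]
  have hset : Set.Iio a ∩ Set.Ioi (0 : ℝ) = Set.Ioo 0 a := by
    rw [Set.inter_comm, Set.Ioi_inter_Iio]
  have hint : IntegrableOn (fun t : ℝ => Real.exp (-t)) (Set.Ioc 0 a) :=
    (by fun_prop : Continuous fun t : ℝ => Real.exp (-t)).integrableOn_Ioc
  rw [hset, setLIntegral_congr Ioo_ae_eq_Ioc, ← ofReal_integral_eq_lintegral_ofReal hint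
    (Eventually.of_forall fun t => (Real.exp_pos _).le), ← intervalIntegral.integral_of_le ha]
  rw [intervalIntegral.integral_comp_neg (fun t => Real.exp t), integral_exp]
  simp

theorem volume_lt_div_norm_rpow {d : ℕ} (hd : d ≠ 0) {α c t : ℝ} (hα : 0 < α) (hc : 0 < c)
    (ht : 0 < t) :
    volume {y : EuclideanSpace ℝ (Fin d) | t < c / ‖y‖ ^ α} =
      ENNReal.ofReal (sphereArea d / d * c ^ ((d : ℝ) / α) * t ^ (-((d : ℝ) / α))) := by
  have : Nonempty (Fin d) := ⟨⟨0, Nat.pos_of_ne_zero hd⟩⟩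
  have hset : {y : EuclideanSpace ℝ (Fin d) | t < c / ‖y‖ ^ α} =
      Metric.ball 0 ((c / t) ^ (1 / α)) \ {0} := by
    ext y
    simp only [Set.mem_ofPred_eq, Set.mem_sdiff, Metric.mem_ball, dist_zero_right,
      Set.mem_singleton_iff]
    rcases eq_or_ne y 0 with rfl | hy
    -- At the origin division by zero gives the value 0, so the superlevel set is a punctured ball.
    · simp [Real.zero_rpow hα.ne', ht.le]
    · have hy0 : 0 < ‖y‖ := norm_pos_iff.2 hy
      have hyα : 0 < ‖y‖ ^ α := Real.rpow_pos_of_pos hy0 α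
      simp only [hy, not_false_eq_true, and_true]
      rw [one_div, Real.lt_rpow_inv_iff_of_pos hy0.le (by positivity) hα, lt_div_iff₀ hyα,
        lt_div_iff₀ ht, mul_comm]
  have hd0 : (0 : ℝ) < d := by exact_mod_cast Nat.pos_of_ne_zero hd
  have : Nontrivial (EuclideanSpace ℝ (Fin d)) := inferInstance
  rw [hset, measure_sdiff_null (measure_singleton 0), EuclideanSpace.volume_ball, Fintype.card_fin,
    ← ENNReal.ofReal_pow (by positivity), ← ENNReal.ofReal_mul (by positivity)]
  congr 1
  have h1 : ((c / t) ^ (1 / α)) ^ d = c ^ ((d : ℝ) / α) * t ^ (-((d : ℝ) / α)) := by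
    rw [← Real.rpow_natCast, ← Real.rpow_mul (by positivity), Real.div_rpow hc.le ht.le,
      Real.rpow_neg ht.le, one_div, inv_mul_eq_div, div_eq_mul_inv]
  have h2 : Real.sqrt Real.pi ^ d = Real.pi ^ ((d : ℝ) / 2) := by
    rw [Real.sqrt_eq_rpow, ← Real.rpow_natCast, ← Real.rpow_mul Real.pi_pos.le]
    congr 1
    ring
  have h3 : Real.Gamma ((d : ℝ) / 2) ≠ 0 := (Real.Gamma_pos_of_pos (by positivity)).ne'
  rw [h1, h2, Real.Gamma_add_one (by positivity), sphereArea]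
  field_simp

/-- The total connection mass of a point in the whole space. -/
theorem lintegral_one_sub_exp_neg_div_norm_rpow {d : ℕ} (hd : d ≠ 0) {α c : ℝ} (hα : (d : ℝ) < α)
    (hc : 0 < c) :
    ∫⁻ y : EuclideanSpace ℝ (Fin d), ENNReal.ofReal (1 - Real.exp (-(c / ‖y‖ ^ α))) =
      ENNReal.ofReal (sphereArea d / d * c ^ ((d : ℝ) / α) * Real.Gamma (1 - d / α)) := by
  have hd0 : (0 : ℝ) < d := by exact_mod_cast Nat.pos_of_ne_zero hd
  have hα0 : 0 < α := hd0.trans hα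
  have hq : (d : ℝ) / α < 1 := (div_lt_one hα0).2 hα
  have hS : 0 ≤ sphereArea d := by
    have := Real.Gamma_pos_of_pos (half_pos hd0)
    unfold sphereArea
    positivity
  have hms : MeasurableSet {p : EuclideanSpace ℝ (Fin d) × ℝ | p.2 < c / ‖p.1‖ ^ α} :=
    measurableSet_lt (by fun_prop) (by fun_prop)
  have hm : Measurable fun p : EuclideanSpace ℝ (Fin d) × ℝ =>
      {p : EuclideanSpace ℝ (Fin d) × ℝ | p.2 < c / ‖p.1‖ ^ α}.indicator
        (fun p => ENNReal.ofReal (Real.exp (-p.2))) p :=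
    Measurable.indicator (by fun_prop) hms
  calc _ = ∫⁻ y : EuclideanSpace ℝ (Fin d), ∫⁻ t in Set.Ioi 0,
        {p : EuclideanSpace ℝ (Fin d) × ℝ | p.2 < c / ‖p.1‖ ^ α}.indicator
        (fun p => ENNReal.ofReal (Real.exp (-p.2))) (y, t) := by
        refine lintegral_congr fun y => ?_
        rw [ofReal_one_sub_exp_neg (by positivity)]
        rfl
    _ = ∫⁻ t in Set.Ioi 0, ∫⁻ y : EuclideanSpace ℝ (Fin d),
        {p : EuclideanSpace ℝ (Fin d) × ℝ | p.2 < c / ‖p.1‖ ^ α}.indicator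
        (fun p => ENNReal.ofReal (Real.exp (-p.2))) (y, t) :=
        lintegral_lintegral_swap hm.aemeasurable
    _ = ∫⁻ t in Set.Ioi 0, ENNReal.ofReal (sphereArea d / d * c ^ ((d : ℝ) / α) *
          (Real.exp (-t) * t ^ ((1 - (d : ℝ) / α) - 1))) := by
        refine setLIntegral_congr_fun measurableSet_Ioi fun t ht => ?_
        have ht0 : (0 : ℝ) < t := ht
        have hmt : MeasurableSet {y : EuclideanSpace ℝ (Fin d) | t < c / ‖y‖ ^ α} :=
          measurableSet_lt (by fun_prop) (by fun_prop)
        calc _ = ∫⁻ y, {y : EuclideanSpace ℝ (Fin d) | t < c / ‖y‖ ^ α}.indicator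
              (fun _ => ENNReal.ofReal (Real.exp (-t))) y := lintegral_congr fun y => rfl
          _ = _ := by
              rw [lintegral_indicator_const hmt, volume_lt_div_norm_rpow hd hα0 hc ht0,
                ← ENNReal.ofReal_mul (Real.exp_pos _).le]
              congr 1
              rw [show (1 - (d : ℝ) / α) - 1 = -((d : ℝ) / α) by ring]
              ring
    _ = _ := by
        -- The remaining integral is Euler's for Γ(1 - d/α), convergent because d < α.
        rw [← ofReal_integral_eq_lintegral_ofReal
          ((Real.GammaIntegral_convergent (by linarith)).const_mul _), integral_const_mul,
          ← Real.Gamma_eq_integral (by linarith)]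
        refine (ae_restrict_iff' measurableSet_Ioi).2 (Eventually.of_forall fun t ht => ?_)
        have ht0 : (0 : ℝ) < t := ht
        simp only [Pi.zero_apply]
        positivity

theorem half_le_norm_of_notMem_cube {d : ℕ} {y : EuclideanSpace ℝ (Fin d)} (hy : y ∉ cube d) :
    1 / 2 ≤ ‖y‖ := by
  by_contra! h
  refine hy fun i => ?_
  have h1 : |y i| < 1 / 2 := (PiLp.norm_apply_le y i).trans_lt h
  rw [abs_lt] at h1
  exact ⟨by linarith [h1.1], h1.2.le⟩

/-- Outside the cube 1 - e^{-a} ≤ a suffices, as ‖y‖^{-α} is integrable at infinity. The constant `3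
^ α` comes from 1 + ‖y‖ ≤ 3‖y‖ when ‖y‖ ≥ 1/2. Linearity in `c` allows averaging over a weight of
finite mean. -/
theorem exists_lintegral_compl_cube_le {d : ℕ} {α : ℝ} (hα : (d : ℝ) < α) :
    ∃ J : ℝ, 0 ≤ J ∧ ∀ c : ℝ, 0 ≤ c →
      ∫⁻ y in (cube d)ᶜ, ENNReal.ofReal (1 - Real.exp (-(c / ‖y‖ ^ α))) ≤
        ENNReal.ofReal (c * J) := by
  have hα0 : 0 < α := (Nat.cast_nonneg d).trans_lt hα
  have hint : Integrable fun y : EuclideanSpace ℝ (Fin d) => (1 + ‖y‖) ^ (-α) :=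
    integrable_one_add_norm (by simpa using hα)
  refine ⟨3 ^ α * ∫ y : EuclideanSpace ℝ (Fin d), (1 + ‖y‖) ^ (-α), ?_, fun c hc => ?_⟩
  · exact mul_nonneg (by positivity) (integral_nonneg fun y => by positivity)
  calc _ ≤ ∫⁻ y in (cube d)ᶜ, ENNReal.ofReal (c * 3 ^ α * (1 + ‖y‖) ^ (-α)) := by
        refine setLIntegral_mono' (measurableSet_cube d).compl fun y hy => ?_
        refine ENNReal.ofReal_le_ofReal ?_
        have hy2 := half_le_norm_of_notMem_cube hy
        have h1 : 1 - Real.exp (-(c / ‖y‖ ^ α)) ≤ c / ‖y‖ ^ α := by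
          linarith [Real.add_one_le_exp (-(c / ‖y‖ ^ α))]
        refine h1.trans ?_
        have h2 : (1 + ‖y‖) ^ α ≤ 3 ^ α * ‖y‖ ^ α := by
          rw [← Real.mul_rpow (by norm_num) (norm_nonneg y)]
          exact Real.rpow_le_rpow (by positivity) (by linarith) hα0.le
        rw [Real.rpow_neg (by positivity), ← div_eq_mul_inv,
          div_le_div_iff₀ (Real.rpow_pos_of_pos (by linarith) α) (by positivity)]
        calc c * (1 + ‖y‖) ^ α ≤ c * (3 ^ α * ‖y‖ ^ α) := by gcongr
          _ = _ := by ring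
    _ ≤ ∫⁻ y, ENNReal.ofReal (c * 3 ^ α * (1 + ‖y‖) ^ (-α)) := setLIntegral_le_lintegral _ _
    _ = _ := by
        rw [← ofReal_integral_eq_lintegral_ofReal (hint.const_mul _)
          (Eventually.of_forall fun y => by simp only [Pi.zero_apply]; positivity),
          integral_const_mul, mul_assoc]

theorem connMass_eq_of_pos {d : ℕ} {α β η r : ℝ} (hβ : 0 < β) (hr : 0 < r) (w : ℝ) :
    connMass d α β η r 0 w = ∫⁻ w', (∫⁻ y in cube d,
      ENNReal.ofReal (1 - Real.exp (-(η * w * w' * r ^ α / ‖y‖ ^ α)))) ∂(paretoMeasure 1 β) := by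
  rw [connMass_eq hβ]
  have h : ∀ (w' : ℝ) (y : EuclideanSpace ℝ (Fin d)),
      η * w * w' / (‖y‖ / r) ^ α = η * w * w' * r ^ α / ‖y‖ ^ α := by
    intro w' y
    rw [Real.div_rpow (norm_nonneg y) hr.le, div_div_eq_mul_div]
  simp_rw [h]

/-- Needed for large weights, where the lower bound with error linear in `w` may be useless:
monotonicity carries the bound at `w = 2` to all larger weights. -/
theorem connMass_mono {d : ℕ} {α β η r : ℝ} (hβ : 0 < β) (hη : 0 < η) (hr : 0 < r) :
    Monotone (connMass d α β η r 0) := by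
  intro w₁ w₂ hw
  rw [connMass_eq_of_pos hβ hr, connMass_eq_of_pos hβ hr]
  refine lintegral_mono_ae ?_
  filter_upwards [ae_one_le_paretoMeasure β] with w' hw'
  refine lintegral_mono fun y => ENNReal.ofReal_le_ofReal ?_
  gcongr

/-- The moment E[W^{d/α}] = αβ/(αβ - d), finite since d/α < 1 < β, completes the constant `c₀`. -/
theorem lintegral_fullMass {d : ℕ} (hd : d ≠ 0) {α β η r w : ℝ} (hα : (d : ℝ) < α) (hβ : 1 < β)
    (hη : 0 < η) (hr : 0 < r) (hw : 0 < w) :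
    ∫⁻ w', (∫⁻ y : EuclideanSpace ℝ (Fin d),
      ENNReal.ofReal (1 - Real.exp (-(η * w * w' * r ^ α / ‖y‖ ^ α)))) ∂(paretoMeasure 1 β) =
      ENNReal.ofReal (c₀ d α β η * r ^ d * w ^ ((d : ℝ) / α)) := by
  have hd0 : (0 : ℝ) < d := by exact_mod_cast Nat.pos_of_ne_zero hd
  have hα0 : 0 < α := hd0.trans hα
  have hq : (d : ℝ) / α < 1 := (div_lt_one hα0).2 hα
  have hS : 0 ≤ sphereArea d := by
    have := Real.Gamma_pos_of_pos (half_pos hd0)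
    unfold sphereArea
    positivity
  have hG : 0 < Real.Gamma (1 - d / α) := Real.Gamma_pos_of_pos (by linarith)
  have hrd : (r ^ α) ^ ((d : ℝ) / α) = r ^ d := by
    rw [← Real.rpow_mul hr.le, mul_div_cancel₀ _ hα0.ne', Real.rpow_natCast]
  calc _ = ∫⁻ w', ENNReal.ofReal (sphereArea d / d * (η ^ ((d : ℝ) / α) * w ^ ((d : ℝ) / α) *
        r ^ d) * Real.Gamma (1 - d / α)) * ENNReal.ofReal (w' ^ ((d : ℝ) / α))
        ∂(paretoMeasure 1 β) := by
        refine lintegral_congr_ae ?_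
        filter_upwards [ae_one_le_paretoMeasure β] with w' hw'
        have hw0 : 0 < w' := by linarith
        rw [lintegral_one_sub_exp_neg_div_norm_rpow hd hα (by positivity),
          ← ENNReal.ofReal_mul (by positivity), Real.mul_rpow (by positivity) (by positivity),
          Real.mul_rpow (by positivity) (by positivity), Real.mul_rpow hη.le hw.le, hrd]
        congr 1
        ring
    _ = _ := by
        rw [lintegral_const_mul _ (by fun_prop),
          lintegral_rpow_paretoMeasure (by linarith) (by linarith),
          ← ENNReal.ofReal_mul (by positivity)]
        congr 1
        have h1 : α * β - d ≠ 0 := by nlinarith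
        have h2 : β - d / α = (α * β - d) / α := by field_simp
        rw [h2, c₀]
        field_simp

/-- The mass of connections inside the torus agrees with the mass in the whole space up to an
error of order `r ^ α`. -/
theorem exists_connMass_bounds {d : ℕ} (hd : d ≠ 0) {α β η : ℝ} (hα : (d : ℝ) < α) (hβ : 1 < β)
    (hη : 0 < η) :
    ∃ K : ℝ, 0 ≤ K ∧ ∀ r : ℝ, 0 < r → ∀ w : ℝ, 1 ≤ w →
      (connMass d α β η r 0 w).toReal ≤ c₀ d α β η * r ^ d * w ^ ((d : ℝ) / α) ∧
      c₀ d α β η * r ^ d * w ^ ((d : ℝ) / α) - K * r ^ α * w ≤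
        (connMass d α β η r 0 w).toReal := by
  obtain ⟨J, hJ0, hJ⟩ := exists_lintegral_compl_cube_le hα
  have hβ0 : 0 < β := by linarith
  have hβ1 : 0 < β - 1 := by linarith
  have : IsProbabilityMeasure (paretoMeasure 1 β) :=
    isProbabilityMeasure_paretoMeasure one_pos hβ0
  -- `J` bounds the mass outside the cube and β/(β - 1) is the mean weight of the other endpoint.
  refine ⟨η * J * (β / (β - 1)), by positivity, fun r hr w hw => ?_⟩
  have hw0 : 0 < w := by linarith
  have hfull := lintegral_fullMass hd hα hβ hη hr hw0
  have hd0 : (0 : ℝ) < d := by exact_mod_cast Nat.pos_of_ne_zero hd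
  have hα0 : 0 < α := hd0.trans hα
  have hq : (d : ℝ) / α < 1 := (div_lt_one hα0).2 hα
  have hc₀ : 0 ≤ c₀ d α β η := by
    have := Real.Gamma_pos_of_pos (half_pos hd0)
    have : 0 < Real.Gamma (1 - d / α) := Real.Gamma_pos_of_pos (by linarith)
    have : 0 < α * β - d := by nlinarith
    unfold c₀ sphereArea
    positivity
  set M := c₀ d α β η * r ^ d * w ^ ((d : ℝ) / α) with hM
  have hM0 : 0 ≤ M := by positivity
  have hL := connMass_eq_of_pos (d := d) (α := α) (η := η) hβ0 hr w
  have hupper : connMass d α β η r 0 w ≤ ENNReal.ofReal M := by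
    rw [hL, ← hfull]
    exact lintegral_mono fun w' => setLIntegral_le_lintegral _ _
  have htop : connMass d α β η r 0 w ≠ ∞ := ne_top_of_le_ne_top ENNReal.ofReal_ne_top hupper
  have hlower : ENNReal.ofReal M ≤ connMass d α β η r 0 w +
      ENNReal.ofReal (η * J * (β / (β - 1)) * r ^ α * w) := by
    rw [hL, ← hfull]
    calc _ ≤ ∫⁻ w', ((∫⁻ y in cube d,
          ENNReal.ofReal (1 - Real.exp (-(η * w * w' * r ^ α / ‖y‖ ^ α)))) +
          ENNReal.ofReal (η * w * r ^ α * J) * ENNReal.ofReal (w' ^ (1 : ℝ)))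
          ∂(paretoMeasure 1 β) := by
          refine lintegral_mono_ae ?_
          filter_upwards [ae_one_le_paretoMeasure β] with w' hw'
          rw [← lintegral_add_compl _ (measurableSet_cube d)]
          gcongr
          refine (hJ _ (by positivity)).trans (le_of_eq ?_)
          rw [← ENNReal.ofReal_mul (by positivity), Real.rpow_one]
          congr 1
          ring
      _ = _ := by
          rw [lintegral_add_right _ (by fun_prop), lintegral_const_mul _ (by fun_prop),
            lintegral_rpow_paretoMeasure hβ0 hβ, ← ENNReal.ofReal_mul (by positivity)]
          congr 2
          ring
  refine ⟨ENNReal.toReal_le_of_le_ofReal hM0 hupper, ?_⟩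
  rw [← ENNReal.ofReal_toReal htop, ← ENNReal.ofReal_add ENNReal.toReal_nonneg (by positivity),
    ENNReal.ofReal_le_ofReal_iff (by positivity)] at hlower
  linarith

/-! ### Laplace asymptotics at the minimal weight. -/

/-- A concave function lies above its chord on [1, 2]; this linear bound gives the exponential
domination near `w = 1`. -/
theorem one_add_mul_le_rpow {p w : ℝ} (hp0 : 0 ≤ p) (hp1 : p ≤ 1) (hw1 : 1 ≤ w) (hw2 : w ≤ 2) :
    1 + (2 ^ p - 1) * (w - 1) ≤ w ^ p := by
  obtain ⟨-, hc⟩ := Real.concaveOn_rpow hp0 hp1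
  have h := hc (Set.mem_Ici.2 zero_le_one) (Set.mem_Ici.2 zero_le_two)
    (by linarith : 0 ≤ 2 - w) (by linarith : 0 ≤ w - 1) (by ring)
  simp only [smul_eq_mul, Real.one_rpow] at h
  rw [show (2 - w) * 1 + (w - 1) * 2 = w by ring] at h
  linarith

theorem pow_mul_exp_neg_le {x ε : ℝ} (k : ℕ) (hx : 0 ≤ x) (hε : 0 < ε) :
    x ^ k * Real.exp (-x) ≤ k.factorial / ε ^ k * Real.exp (-((1 - ε) * x)) := by
  have h := Real.pow_div_factorial_le_exp (ε * x) (by positivity) k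
  have hk : (0 : ℝ) < k.factorial := by positivity
  rw [div_le_iff₀ hk, mul_pow] at h
  have h2 : x ^ k ≤ k.factorial / ε ^ k * Real.exp (ε * x) := by
    rw [div_mul_eq_mul_div, le_div_iff₀ (by positivity)]
    linarith
  calc x ^ k * Real.exp (-x) ≤ k.factorial / ε ^ k * Real.exp (ε * x) * Real.exp (-x) := by gcongr
    _ = _ := by
      rw [mul_assoc, ← Real.exp_add]
      ring_nf

/-- The difference quotient of x^p at 1, with increment `v / m i`. -/
theorem tendsto_mul_one_add_div_rpow_sub_one {ι : Type*} {l : Filter ι} {m : ι → ℝ}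
    (hm : Tendsto m l atTop) (p : ℝ) {v : ℝ} (hv : 0 < v) :
    Tendsto (fun i => m i * ((1 + v / m i) ^ p - 1)) l (𝓝 (p * v)) := by
  have hd : HasDerivAt (fun x : ℝ => x ^ p) p 1 := by
    simpa using Real.hasDerivAt_rpow_const (x := 1) (p := p) (Or.inl one_ne_zero)
  have hs := hasDerivAt_iff_tendsto_slope_zero.1 hd
  have ht : Tendsto (fun i => v / m i) l (𝓝[≠] 0) := by
    refine tendsto_nhdsWithin_iff.2 ⟨hm.const_div_atTop v, ?_⟩
    filter_upwards [hm.eventually_gt_atTop 0] with i hi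
    exact (div_pos hv hi).ne'
  refine ((hs.comp ht).mul_const v).congr' ?_
  filter_upwards [hm.eventually_gt_atTop 0] with i hi
  simp only [Function.comp_apply, smul_eq_mul, Real.one_rpow]
  field_simp

/-- The integrand of the Laplace asymptotics. -/
def laplaceIntegrand (β : ℝ) (k : ℕ) (m : ℝ) (f : ℝ → ℝ) (w : ℝ) : ℝ :=
  β * w ^ (-(β + 1)) * (Real.exp m * ((f w / m) ^ k * Real.exp (-f w)))

theorem integrableOn_laplaceIntegrand {β m : ℝ} (hβ : 0 < β) (hm : 0 < m) (k : ℕ) {f : ℝ → ℝ}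
    (hf : Measurable f) (hf0 : ∀ w, 1 ≤ w → 0 ≤ f w) :
    IntegrableOn (laplaceIntegrand β k m f) (Set.Ioi 1) := by
  have hint := integrableOn_Ioi_rpow_of_lt (by linarith : -(β + 1) < -1) one_pos
  refine (hint.const_mul (β * (Real.exp m * (k.factorial / m ^ k)))).mono' ?_ ?_
  · unfold laplaceIntegrand
    exact (by fun_prop : Measurable _).aestronglyMeasurable
  · refine (ae_restrict_iff' measurableSet_Ioi).2 (Eventually.of_forall fun w hw => ?_)
    have hw1 : (1 : ℝ) < w := hw
    have hfw := hf0 w hw1.le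
    have h : f w ^ k * Real.exp (-f w) ≤ k.factorial := by
      simpa using pow_mul_exp_neg_le k hfw one_pos
    unfold laplaceIntegrand
    rw [Real.norm_of_nonneg (by positivity), div_pow, div_mul_eq_mul_div]
    calc _ ≤ β * w ^ (-(β + 1)) * (Real.exp m * (k.factorial / m ^ k)) := by gcongr
      _ = _ := by ring

/-- The substitution w = 1 + v/m maps (1, 2] to (0, m] and absorbs the factor `m`. Dominated
convergence then applies, with pointwise limit β e^{-pv}. -/
theorem tendsto_laplace_head {ι : Type*} {l : Filter ι} [l.IsCountablyGenerated] {β p : ℝ}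
    (hβ : 0 < β) (hp0 : 0 < p) (hp1 : p ≤ 1) (k : ℕ) {m δ : ι → ℝ} {f : ι → ℝ → ℝ}
    (hm : Tendsto m l atTop) (hδ : Tendsto δ l (𝓝 0)) (hf : ∀ i, Measurable (f i))
    (hf0 : ∀ᶠ i in l, ∀ w, 1 ≤ w → 0 ≤ f i w)
    (hupper : ∀ᶠ i in l, ∀ w, 1 ≤ w → f i w ≤ m i * w ^ p)
    (hlower : ∀ᶠ i in l, ∀ w, 1 ≤ w → m i * w ^ p - δ i * w ≤ f i w) :
    Tendsto (fun i => m i * ∫ w in Set.Ioc 1 2, laplaceIntegrand β k (m i) (f i) w) l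
      (𝓝 (β / p)) := by
  have htwo : (1 : ℝ) < 2 ^ p := Real.one_lt_rpow one_lt_two hp0
  have hb : 0 < (2 : ℝ) ^ p - 1 := by linarith
  set G : ι → ℝ → ℝ := fun i =>
    (Set.Iic (m i)).indicator fun v => laplaceIntegrand β k (m i) (f i) (1 + v / m i) with hG
  have hcv : ∀ᶠ i in l, ∫ v in Set.Ioi 0, G i v =
      m i * ∫ w in Set.Ioc 1 2, laplaceIntegrand β k (m i) (f i) w := by
    filter_upwards [hm.eventually_gt_atTop 0] with i hi
    rw [hG, integral_indicator measurableSet_Iic, Measure.restrict_restrict measurableSet_Iic,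
      Set.inter_comm, Set.Ioi_inter_Iic, ← intervalIntegral.integral_of_le hi.le,
      intervalIntegral.integral_comp_add_div _ hi.ne', zero_div, add_zero, div_self hi.ne',
      smul_eq_mul, one_add_one_eq_two, intervalIntegral.integral_of_le one_le_two]
  refine Tendsto.congr' hcv ?_
  have hlim : ∫ v in Set.Ioi 0, β * Real.exp (-p * v) = β / p := by
    rw [integral_const_mul, integral_exp_mul_Ioi (by linarith) 0]
    simp
    field_simp
  rw [← hlim]
  refine tendsto_integral_filter_of_dominated_convergence
    -- On w ≤ 2: f/m ≤ w^p ≤ 2 gives `2 ^ k`, the error δw ≤ 2 gives `exp 2`, and the chord bound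
    -- gives the decay rate.
    (fun v => β * 2 ^ k * Real.exp 2 * Real.exp (-((2 : ℝ) ^ p - 1) * v)) ?_ ?_ ?_ ?_
  · refine Eventually.of_forall fun i => Measurable.aestronglyMeasurable ?_
    refine Measurable.indicator ?_ measurableSet_Iic
    have := hf i
    unfold laplaceIntegrand
    fun_prop
  · filter_upwards [hm.eventually_gt_atTop 0, hf0, hupper, hlower,
      hδ.eventually_lt_const one_pos] with i hi hpos hu hl hδi
    refine (ae_restrict_iff' measurableSet_Ioi).2 (Eventually.of_forall fun v hv => ?_)
    have hv0 : (0 : ℝ) < v := hv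
    by_cases hvm : v ≤ m i
    · rw [hG]
      simp only [Set.indicator_of_mem (Set.mem_Iic.2 hvm)]
      set w := 1 + v / m i with hw
      have hdiv : v / m i ≤ 1 := (div_le_one hi).2 hvm
      have hdiv0 : 0 < v / m i := div_pos hv0 hi
      have hw1 : 1 ≤ w := by linarith
      have hw2 : w ≤ 2 := by linarith
      have hf0' := hpos w hw1
      have h1 : w ^ (-(β + 1)) ≤ 1 := Real.rpow_le_one_of_one_le_of_nonpos hw1 (by linarith)
      have h2 : f i w / m i ≤ 2 := by
        rw [div_le_iff₀ hi]
        have : w ^ p ≤ 2 := (Real.rpow_le_rpow_of_exponent_le hw1 hp1).trans (by simpa using hw2)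
        nlinarith [hu w hw1]
      have h3 : m i - f i w ≤ 2 + -((2 : ℝ) ^ p - 1) * v := by
        have h4 := one_add_mul_le_rpow hp0.le hp1 hw1 hw2
        have h5 : m i * (w - 1) = v := by
          rw [hw]
          field_simp
          ring
        have h6 : m i * (1 + (2 ^ p - 1) * (w - 1)) ≤ m i * w ^ p := by gcongr
        have h7 : m i * (1 + (2 ^ p - 1) * (w - 1)) = m i + (2 ^ p - 1) * v := by
          rw [← h5]
          ring
        have h8 : δ i * w ≤ 2 := by nlinarith
        linarith [hl w hw1]
      unfold laplaceIntegrand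
      have hw0 : 0 < w := by linarith
      rw [Real.norm_of_nonneg (by positivity)]
      calc _ = β * w ^ (-(β + 1)) * ((f i w / m i) ^ k * Real.exp (m i - f i w)) := by
            rw [sub_eq_add_neg, Real.exp_add]
            ring
        _ ≤ β * 1 * (2 ^ k * Real.exp (2 + -((2 : ℝ) ^ p - 1) * v)) := by gcongr
        _ = _ := by
            rw [Real.exp_add]
            ring
    · rw [hG]
      simp only [Set.indicator_of_notMem (by simpa using hvm : v ∉ Set.Iic (m i)), norm_zero]
      positivity
  · exact (integrableOn_exp_mul_Ioi (by linarith) 0).const_mul _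
  · refine (ae_restrict_iff' measurableSet_Ioi).2 (Eventually.of_forall fun v hv => ?_)
    have hv0 : (0 : ℝ) < v := hv
    have hw : Tendsto (fun i => 1 + v / m i) l (𝓝 1) := by
      simpa using (hm.const_div_atTop v).const_add 1
    have hwp : Tendsto (fun i => (1 + v / m i) ^ p) l (𝓝 1) := by
      simpa using hw.rpow_const (p := p) (Or.inl one_ne_zero)
    have hδw : Tendsto (fun i => δ i * (1 + v / m i)) l (𝓝 0) := by simpa using hδ.mul hw
    have hexp := tendsto_mul_one_add_div_rpow_sub_one hm p hv0
    have hw1 : ∀ᶠ i in l, 1 ≤ 1 + v / m i := by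
      filter_upwards [hm.eventually_gt_atTop 0] with i hi
      have := div_pos hv0 hi
      linarith
    have hdiff : Tendsto (fun i => m i - f i (1 + v / m i)) l (𝓝 (-p * v)) := by
      refine tendsto_of_tendsto_of_tendsto_of_le_of_le'
        (g := fun i => -(m i * ((1 + v / m i) ^ p - 1)))
        (h := fun i => -(m i * ((1 + v / m i) ^ p - 1)) + δ i * (1 + v / m i)) ?_ ?_ ?_ ?_
      · simpa using hexp.neg
      · simpa using hexp.neg.add hδw
      · filter_upwards [hupper, hw1] with i hu h1
        linarith [hu _ h1]
      · filter_upwards [hlower, hw1] with i hl h1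
        linarith [hl _ h1]
    have hratio : Tendsto (fun i => f i (1 + v / m i) / m i) l (𝓝 1) := by
      have h := (hdiff.div_atTop hm).const_sub 1
      rw [sub_zero] at h
      refine h.congr' ?_
      filter_upwards [hm.eventually_gt_atTop 0] with i hi
      field_simp
      ring
    have hpow : Tendsto (fun i => (1 + v / m i) ^ (-(β + 1))) l (𝓝 1) := by
      simpa using hw.rpow_const (p := -(β + 1)) (Or.inl one_ne_zero)
    have hall := (hpow.const_mul β).mul
      ((hratio.pow k).mul ((Real.continuous_exp.tendsto _).comp hdiff))
    rw [mul_one, one_pow, one_mul] at hall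
    refine hall.congr' ?_
    filter_upwards [hm.eventually_ge_atTop v] with i hi
    rw [hG]
    simp only [Set.indicator_of_mem (Set.mem_Iic.2 hi), Function.comp_apply]
    unfold laplaceIntegrand
    rw [sub_eq_add_neg, Real.exp_add]
    ring

/-- For w > 2 monotonicity gives f(w) ≥ f(2) ≥ m 2^p - 2 eventually. As 2^p > 1, the factor e^{m -
f} is exponentially small in `m`, uniformly in `w`, and the Pareto density is integrable. -/
theorem tendsto_laplace_tail {ι : Type*} {l : Filter ι} {β p : ℝ}
    (hβ : 0 < β) (hp0 : 0 < p) (k : ℕ) {m δ : ι → ℝ} {f : ι → ℝ → ℝ}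
    (hm : Tendsto m l atTop) (hδ : Tendsto δ l (𝓝 0))
    (hf0 : ∀ᶠ i in l, ∀ w, 1 ≤ w → 0 ≤ f i w) (hmono : ∀ᶠ i in l, Monotone (f i))
    (hlower : ∀ᶠ i in l, ∀ w, 1 ≤ w → m i * w ^ p - δ i * w ≤ f i w) :
    Tendsto (fun i => m i * ∫ w in Set.Ioi 2, laplaceIntegrand β k (m i) (f i) w) l (𝓝 0) := by
  have hθ : (1 : ℝ) < 2 ^ p := Real.one_lt_rpow one_lt_two hp0
  set θ : ℝ := 2 ^ p with hθdef
  -- Giving up a fraction ε of the exponent absorbs the power f^k; this ε keeps (1 - ε)θ = 1 + (θ -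
  -- 1)/2 above 1.
  set ε : ℝ := (θ - 1) / (2 * θ) with hε
  have hε0 : 0 < ε := div_pos (by linarith) (by linarith)
  have hεθ : (1 - ε) * θ = 1 + (θ - 1) / 2 := by
    rw [hε]
    field_simp
    ring
  have hε1 : 0 ≤ 1 - ε := by
    by_contra! h
    nlinarith
  set b : ℝ := (θ - 1) / 2 with hbdef
  have hb : 0 < b := by rw [hbdef]; linarith
  set C : ℝ := k.factorial / ε ^ k * Real.exp ((1 - ε) * 2) with hC
  have hint := (integrableOn_Ioi_rpow_of_lt (by linarith : -(β + 1) < -1)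
    (two_pos : (0 : ℝ) < 2)).const_mul β
  set I : ℝ := ∫ w in Set.Ioi (2 : ℝ), β * w ^ (-(β + 1)) with hI
  have hbound : Tendsto (fun i => C * I * (m i ^ (1 : ℝ) * Real.exp (-b * m i))) l (𝓝 0) := by
    simpa using ((tendsto_rpow_mul_exp_neg_mul_atTop_nhds_zero 1 b hb).comp hm).const_mul (C * I)
  refine squeeze_zero_norm' ?_ hbound
  filter_upwards [hm.eventually_ge_atTop 1, hf0, hlower, hmono,
      hδ.eventually_lt_const one_pos] with i hi hpos hl hmon hδi
  have hm0 : 0 < m i := by linarith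
  rw [norm_mul, Real.norm_of_nonneg hm0.le, Real.rpow_one]
  have hle : ‖∫ w in Set.Ioi 2, laplaceIntegrand β k (m i) (f i) w‖ ≤
      ∫ w in Set.Ioi (2 : ℝ), (C * Real.exp (-b * m i)) * (β * w ^ (-(β + 1))) := by
    refine norm_integral_le_of_norm_le (hint.const_mul _) ?_
    refine (ae_restrict_iff' measurableSet_Ioi).2 (Eventually.of_forall fun w hw => ?_)
    have hw2 : (2 : ℝ) < w := hw
    have hw0 : 0 < w := by linarith
    have hfw := hpos w (by linarith)
    have h1 : m i * θ - 2 ≤ f i w := by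
      have := hl 2 one_le_two
      linarith [hmon hw2.le]
    unfold laplaceIntegrand
    rw [Real.norm_of_nonneg (by positivity)]
    have h2 : (f i w / m i) ^ k * Real.exp (-f i w) ≤ k.factorial / ε ^ k *
        Real.exp (-((1 - ε) * (m i * θ - 2))) := by
      calc _ ≤ f i w ^ k * Real.exp (-f i w) := by
            gcongr
            exact div_le_self hfw hi
        _ ≤ k.factorial / ε ^ k * Real.exp (-((1 - ε) * f i w)) := pow_mul_exp_neg_le k hfw hε0
        _ ≤ _ := by gcongr
    calc _ ≤ β * w ^ (-(β + 1)) * (Real.exp (m i) * (k.factorial / ε ^ k *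
        Real.exp (-((1 - ε) * (m i * θ - 2))))) := by gcongr
      _ = β * w ^ (-(β + 1)) * (k.factorial / ε ^ k *
          Real.exp (m i + -((1 - ε) * (m i * θ - 2)))) := by
          rw [Real.exp_add]
          ring
      _ = β * w ^ (-(β + 1)) * (k.factorial / ε ^ k * Real.exp ((1 - ε) * 2 + -b * m i)) := by
          congr 3
          linear_combination (-m i) * hεθ
      _ = _ := by
          rw [Real.exp_add, hC]
          ring
  rw [integral_const_mul] at hle
  calc _ ≤ m i * (C * Real.exp (-b * m i) * I) := by gcongr
    _ = _ := by ring

/-- Laplace asymptotics of the mean of `λ^k exp (-λ)`, where `λ` is close to `m w ^ p` and `w` has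
the Pareto law. -/
theorem tendsto_laplace {ι : Type*} {l : Filter ι} [l.IsCountablyGenerated] {β p : ℝ}
    (hβ : 0 < β) (hp0 : 0 < p) (hp1 : p ≤ 1) (k : ℕ) {m δ : ι → ℝ} {f : ι → ℝ → ℝ}
    (hm : Tendsto m l atTop) (hδ : Tendsto δ l (𝓝 0)) (hf : ∀ i, Measurable (f i))
    (hf0 : ∀ᶠ i in l, ∀ w, 1 ≤ w → 0 ≤ f i w) (hmono : ∀ᶠ i in l, Monotone (f i))
    (hupper : ∀ᶠ i in l, ∀ w, 1 ≤ w → f i w ≤ m i * w ^ p)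
    (hlower : ∀ᶠ i in l, ∀ w, 1 ≤ w → m i * w ^ p - δ i * w ≤ f i w) :
    Tendsto (fun i => m i * ∫ w in Set.Ioi 1, laplaceIntegrand β k (m i) (f i) w) l
      (𝓝 (β / p)) := by
  have h := (tendsto_laplace_head hβ hp0 hp1 k hm hδ hf hf0 hupper hlower).add
    (tendsto_laplace_tail hβ hp0 k hm hδ hf0 hmono hlower)
  rw [add_zero] at h
  refine h.congr' ?_
  filter_upwards [hm.eventually_gt_atTop 0, hf0] with i hi hpos
  have hint := integrableOn_laplaceIntegrand hβ hi k (hf i) hpos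
  rw [← mul_add, ← setIntegral_union (Set.Ioc_disjoint_Ioi le_rfl) measurableSet_Ioi
    (hint.mono_set Set.Ioc_subset_Ioi_self) (hint.mono_set (Set.Ioi_subset_Ioi one_le_two)),
    Set.Ioc_union_Ioi_eq_Ioi one_le_two]

/-! ### Integrability, and the expectation as a real integral. -/

theorem measurable_numDegree_real {d : ℕ} (α η r : ℝ) (k : ℕ) :
    Measurable fun ω : Sample d => (numDegree α η r k ω : ℝ) := by
  simpa using (measurable_numDegree (d := d) α η r k).ennreal_toReal

/-- In the Mecke formula a Poisson probability is at most 1, so the mean is at most `s`. -/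
theorem integrable_numDegree {d : ℕ} {α β η r s : ℝ} (hβ : 0 < β) (hs : 0 < s) (k : ℕ) :
    Integrable (fun ω => (numDegree α η r k ω : ℝ)) (law d β s) := by
  have : IsProbabilityMeasure (paretoMeasure 1 β) :=
    isProbabilityMeasure_paretoMeasure one_pos hβ
  refine ⟨(measurable_numDegree_real α η r k).aestronglyMeasurable, ?_⟩
  rw [hasFiniteIntegral_iff_ofReal (Eventually.of_forall fun ω => Nat.cast_nonneg _)]
  simp_rw [ENNReal.ofReal_natCast]
  rw [lintegral_numDegree hβ hs (connMass_eq_zero_left hβ) k]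
  calc _ ≤ ∫⁻ _, ENNReal.ofReal s ∂(paretoMeasure 1 β) := by
        refine lintegral_mono fun a => ENNReal.ofReal_le_ofReal ?_
        set x := s * (connMass d α β η r 0 a).toReal
        have hx : 0 ≤ x := mul_nonneg hs.le ENNReal.toReal_nonneg
        have h := Real.pow_div_factorial_le_exp x hx k
        have h2 : x ^ k / k.factorial * Real.exp (-x) ≤ 1 := by
          rw [Real.exp_neg, ← div_eq_mul_inv]
          exact (div_le_one (Real.exp_pos x)).2 h
        nlinarith
    _ < ∞ := by simp

theorem integral_numDegree {d : ℕ} {α β η r s : ℝ} (hβ : 0 < β) (hs : 0 < s) (k : ℕ) :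
    ∫ ω, (numDegree α η r k ω : ℝ) ∂(law d β s) =
      ∫ w in Set.Ioi 1, β * w ^ (-(β + 1)) * (s * ((s * (connMass d α β η r 0 w).toReal) ^ k /
        k.factorial * Real.exp (-(s * (connMass d α β η r 0 w).toReal)))) := by
  have hm : Measurable fun w => (connMass d α β η r 0 w).toReal :=
    (measurable_connMass hβ 0).ennreal_toReal
  rw [integral_eq_lintegral_of_nonneg_ae (Eventually.of_forall fun ω => Nat.cast_nonneg _)
    (measurable_numDegree_real α η r k).aestronglyMeasurable]
  simp_rw [ENNReal.ofReal_natCast]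
  rw [lintegral_numDegree hβ hs (connMass_eq_zero_left hβ) k,
    lintegral_paretoMeasure β (by fun_prop), integral_eq_lintegral_of_nonneg_ae]
  · congr 1
    refine setLIntegral_congr_fun measurableSet_Ioi fun w hw => ?_
    have hw0 : (0 : ℝ) < w := lt_trans one_pos hw
    exact (ENNReal.ofReal_mul (by positivity)).symm
  · refine (ae_restrict_iff' measurableSet_Ioi).2 (Eventually.of_forall fun w hw => ?_)
    have hw0 : (0 : ℝ) < w := lt_trans one_pos hw
    simp only [Pi.zero_apply]
    positivity
  · exact (by fun_prop : Measurable _).aestronglyMeasurable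

/-! ### Asymptotics of the scaling, and conclusion. -/

/-- The mean degree `c₀ s r_s^d` of a point of weight one, up to boundary effects. -/
def meanDegree (d : ℕ) (α β ξ : ℝ) (k : ℕ) (s : ℝ) : ℝ :=
  Real.log s + ((k : ℝ) - 1) * Real.log (Real.log s) + ξ + Real.log (α * β / (k.factorial * d))

theorem tendsto_meanDegree_div_log (d : ℕ) (α β ξ : ℝ) (k : ℕ) :
    Tendsto (fun s => meanDegree d α β ξ k s / Real.log s) atTop (𝓝 1) := by
  have h1 : Tendsto (fun s => Real.log (Real.log s) / Real.log s) atTop (𝓝 0) :=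
    Real.isLittleO_log_id_atTop.tendsto_div_nhds_zero.comp Real.tendsto_log_atTop
  have h2 : Tendsto (fun s => (ξ + Real.log (α * β / (k.factorial * d))) / Real.log s) atTop
      (𝓝 0) := Real.tendsto_log_atTop.const_div_atTop _
  have h := ((h1.const_mul ((k : ℝ) - 1)).add h2).const_add 1
  simp only [mul_zero, add_zero] at h
  refine h.congr' ?_
  filter_upwards [Real.tendsto_log_atTop.eventually_gt_atTop 0] with s hs
  unfold meanDegree
  field_simp
  ring

theorem tendsto_meanDegree_atTop (d : ℕ) (α β ξ : ℝ) (k : ℕ) :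
    Tendsto (meanDegree d α β ξ k) atTop atTop := by
  have h := (tendsto_meanDegree_div_log d α β ξ k).pos_mul_atTop one_pos Real.tendsto_log_atTop
  refine h.congr' ?_
  filter_upwards [Real.tendsto_log_atTop.eventually_gt_atTop 0] with s hs
  field_simp

/-- By the choice of the scale, s e^{-m} equals (log s)^{1-k} times the limiting constant, so the
expression is (m / log s)^{k-1} times that constant. -/
theorem tendsto_mul_exp_neg_meanDegree {d : ℕ} (hd : d ≠ 0) {α β : ℝ} (hα : 0 < α) (hβ : 0 < β)
    (ξ : ℝ) (k : ℕ) :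
    Tendsto (fun s => s * Real.exp (-meanDegree d α β ξ k s) * meanDegree d α β ξ k s ^ k /
      meanDegree d α β ξ k s) atTop (𝓝 (Real.exp (-ξ) * (k.factorial * d / (α * β)))) := by
  have hd0 : (0 : ℝ) < d := by exact_mod_cast Nat.pos_of_ne_zero hd
  have hfac : (0 : ℝ) < k.factorial := by positivity
  have h := ((tendsto_meanDegree_div_log d α β ξ k).rpow_const (p := (k : ℝ) - 1)
    (Or.inl one_ne_zero)).mul_const (Real.exp (-ξ) * (k.factorial * d / (α * β)))
  rw [Real.one_rpow, one_mul] at h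
  refine h.congr' ?_
  filter_upwards [Real.tendsto_log_atTop.eventually_gt_atTop 0, eventually_gt_atTop 0,
    (tendsto_meanDegree_atTop d α β ξ k).eventually_gt_atTop 0] with s hlog hs hm
  have hexp : Real.exp (-meanDegree d α β ξ k s) =
      s⁻¹ * (Real.log s ^ ((k : ℝ) - 1))⁻¹ * Real.exp (-ξ) * (k.factorial * d / (α * β)) := by
    rw [meanDegree, Real.exp_neg, Real.exp_add, Real.exp_add, Real.exp_add, Real.exp_log hs,
      Real.exp_log (by positivity), Real.rpow_def_of_pos hlog, Real.exp_neg,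
      mul_comm ((k : ℝ) - 1)]
    field_simp
  rw [hexp, Real.div_rpow hm.le hlog.le, Real.rpow_sub_one hm.ne', Real.rpow_natCast]
  field_simp

theorem scale_eq (d : ℕ) (α β η ξ : ℝ) (k : ℕ) (s : ℝ) :
    scale d α β η ξ k s =
      (meanDegree d α β ξ k s / (c₀ d α β η * s)) ^ (1 / (d : ℝ)) := by
  rw [scale, one_div_mul_eq_div]
  rfl

theorem c₀_pos {d : ℕ} (hd : d ≠ 0) {α β η : ℝ} (hα : (d : ℝ) < α) (hβ : 1 < β) (hη : 0 < η) :
    0 < c₀ d α β η := by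
  have hd0 : (0 : ℝ) < d := by exact_mod_cast Nat.pos_of_ne_zero hd
  have hα0 : 0 < α := hd0.trans hα
  have hq : (d : ℝ) / α < 1 := (div_lt_one hα0).2 hα
  have := Real.Gamma_pos_of_pos (half_pos hd0)
  have : 0 < Real.Gamma (1 - d / α) := Real.Gamma_pos_of_pos (by linarith)
  have : 0 < α * β - d := by nlinarith
  unfold c₀ sphereArea
  positivity

/-- Here r^α is of order (log s / s)^{α/d} with α/d > 1, so a negative power of `s` beats the
logarithm. This removes the boundary effects. -/
theorem tendsto_mul_scale_rpow {d : ℕ} (hd : d ≠ 0) {α β η : ℝ} (hα : (d : ℝ) < α) (hβ : 1 < β)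
    (hη : 0 < η) (ξ : ℝ) (k : ℕ) :
    Tendsto (fun s => s * scale d α β η ξ k s ^ α) atTop (𝓝 0) := by
  have hd0 : (0 : ℝ) < d := by exact_mod_cast Nat.pos_of_ne_zero hd
  have hc := c₀_pos hd hα hβ hη
  have hq : 1 < α / d := (one_lt_div hd0).2 hα
  have h1 := (tendsto_meanDegree_div_log d α β ξ k).rpow_const (p := α / d) (Or.inl one_ne_zero)
  have h2 := (isLittleO_log_rpow_rpow_atTop (α / d)
    (by linarith : 0 < α / d - 1)).tendsto_div_nhds_zero
  have h := (h1.mul h2).const_mul (c₀ d α β η ^ (α / d))⁻¹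
  rw [mul_zero, mul_zero] at h
  refine h.congr' ?_
  filter_upwards [Real.tendsto_log_atTop.eventually_gt_atTop 0, eventually_gt_atTop 0,
    (tendsto_meanDegree_atTop d α β ξ k).eventually_gt_atTop 0] with s hlog hs hm
  rw [scale_eq, ← Real.rpow_mul (by positivity), one_div_mul_eq_div,
    Real.div_rpow hm.le (mul_pos hc hs).le, Real.mul_rpow hc.le hs.le,
    Real.div_rpow hm.le hlog.le,
    Real.rpow_sub_one hs.ne']
  have := Real.rpow_pos_of_pos hlog (α / d)
  field_simp

theorem tendsto_integral_numDegree {d : ℕ} (hd : d ≠ 0) {α β η : ℝ} (hα : (d : ℝ) < α)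
    (hβ : 1 < β) (hη : 0 < η) (ξ : ℝ) (k : ℕ) :
    Tendsto (fun s : ℝ => ∫ ω, (numDegree α η (scale d α β η ξ k s) k ω : ℝ) ∂(law d β s))
      atTop (𝓝 (Real.exp (-ξ))) := by
  have hd0 : (0 : ℝ) < d := by exact_mod_cast Nat.pos_of_ne_zero hd
  have hα0 : 0 < α := hd0.trans hα
  have hβ0 : 0 < β := by linarith
  have hc := c₀_pos hd hα hβ hη
  set m := meanDegree d α β ξ k with hmdef
  have hm : Tendsto m atTop atTop := tendsto_meanDegree_atTop d α β ξ k
  set r := scale d α β η ξ k with hr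
  set f : ℝ → ℝ → ℝ := fun s w => s * (connMass d α β η (r s) 0 w).toReal with hf
  obtain ⟨K, -, hK⟩ := exists_connMass_bounds hd hα hβ hη
  have hrpos : ∀ᶠ s in atTop, 0 < r s ∧ c₀ d α β η * r s ^ d * s = m s := by
    filter_upwards [eventually_gt_atTop 0, hm.eventually_gt_atTop 0] with s hs hms
    have hb : 0 < m s / (c₀ d α β η * s) := by positivity
    rw [hr, scale_eq]
    refine ⟨Real.rpow_pos_of_pos hb _, ?_⟩
    rw [← Real.rpow_natCast, ← Real.rpow_mul hb.le, one_div_mul_cancel hd0.ne', Real.rpow_one]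
    field_simp
  have hδ : Tendsto (fun s => K * (s * r s ^ α)) atTop (𝓝 0) := by
    simpa using (tendsto_mul_scale_rpow hd hα hβ hη ξ k).const_mul K
  have hlap := tendsto_laplace (l := atTop) (β := β) (p := d / α) (m := m)
    (δ := fun s => K * (s * r s ^ α)) (f := f) hβ0 (by positivity)
    ((div_le_one hα0).2 hα.le) k hm hδ
    (fun s => (measurable_connMass hβ0 0).ennreal_toReal.const_mul s)
    (by
      filter_upwards [eventually_gt_atTop 0] with s hs w _
      exact mul_nonneg hs.le ENNReal.toReal_nonneg)
    (by
      filter_upwards [eventually_gt_atTop 0, hrpos] with s hs hrs w₁ w₂ hw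
      have htop : connMass d α β η (r s) 0 w₂ ≠ ∞ :=
        ne_top_of_le_ne_top ENNReal.one_ne_top (connMass_le_one hβ0 0 w₂)
      exact mul_le_mul_of_nonneg_left
        (ENNReal.toReal_mono htop (connMass_mono hβ0 hη hrs.1 hw)) hs.le)
    (by
      filter_upwards [eventually_gt_atTop 0, hrpos] with s hs hrs w hw
      have h := mul_le_mul_of_nonneg_left (hK (r s) hrs.1 w hw).1 hs.le
      rw [← hrs.2]
      linarith)
    (by
      filter_upwards [eventually_gt_atTop 0, hrpos] with s hs hrs w hw
      have h := mul_le_mul_of_nonneg_left (hK (r s) hrs.1 w hw).2 hs.le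
      rw [← hrs.2]
      linarith)
  have hpre := (tendsto_mul_exp_neg_meanDegree hd hα0 hβ0 ξ k).div_const (k.factorial : ℝ)
  have h := hpre.mul hlap
  -- The Laplace limit β/(d/α) cancels the constant log(αβ/(k! d)) built into the scale.
  have hval : Real.exp (-ξ) * (k.factorial * d / (α * β)) / k.factorial * (β / (d / α)) =
      Real.exp (-ξ) := by
    field_simp
  rw [hval] at h
  refine h.congr' ?_
  filter_upwards [eventually_gt_atTop 0, hm.eventually_gt_atTop 0] with s hs hms
  rw [integral_numDegree hβ0 hs k, ← mul_assoc, ← integral_const_mul]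
  refine integral_congr_ae (Eventually.of_forall fun w => ?_)
  simp only [laplaceIntegrand, ← hmdef]
  rw [Real.exp_neg (m s), div_pow]
  field_simp
  rfl

end ScaleFreeRCM

end

theorem theorem3p1 (d : ℕ) (hd : 2 ≤ d) (α β η ξ : ℝ) (hα : (d : ℝ) < α) (hβ : 1 < β)
    (hη : 0 < η) (k : ℕ) :
    (∀ s : ℝ, 0 < s →
      Integrable (fun ω => (ScaleFreeRCM.numDegree α η (ScaleFreeRCM.scale d α β η ξ k s) k ω : ℝ))
        (ScaleFreeRCM.law d β s)) ∧
    Tendsto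
      (fun s : ℝ => ∫ ω, (ScaleFreeRCM.numDegree α η (ScaleFreeRCM.scale d α β η ξ k s) k ω : ℝ)
        ∂(ScaleFreeRCM.law d β s))
      atTop (𝓝 (Real.exp (-ξ))) := by
  exact ⟨fun s hs => ScaleFreeRCM.integrable_numDegree (by linarith) hs k,
    ScaleFreeRCM.tendsto_integral_numDegree (by omega) hα hβ hη ξ k⟩
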